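/- **Setting.** Let $d\ge 1$, $Q_N=[-N-\tfrac12,N+\tfrac12]^d$ for $N\in\mathbb N$, and $Q=Q_0$. Let $H^1_{\rm per}(Q_N)$ be the closure, for the $H^1(Q_N)$-norm, of the smooth $Q_N$-periodic functions (those with periods $(2N+1)k$, $k\in\mathbb Z^d$). Let $(\Omega,\mathcal F,\mathbb P)$ be a probability space with a measurable, measure-preserving, ergodic action $(\tau_k)_{k\in\mathbb Z^d}$ of $\mathbb Z^d$. A random field $F$ on $\mathbb R^d\times\Omega$ is called stationary if, for every $k\in\mathbb Z^d$, $F(x+k,\omega)=F(x,\tau_k\omega)$ for almost every $x$ and almost every $\omega$. For $|\eta|\le 1$ let $A_\eta(x,\omega)$ be a measurable stationary random $d\times d$ matrix field. Assume that there are $\gamma>0$ and $M>0$, independent of $\eta$, such that $\xi^TA_\eta\xi\ge\gamma|\xi|^2$ almost everywhere and almost surely for every $\xi\in\mathbb R^d$, and $\|A_\eta\|_{L^\infty(\mathbb R^d\times\Omega)}\le M$. Assume moreover that $$A_\eta(x,\omega)=A_{\rm per}(x)+\eta A_1(x,\omega)+R_\eta(x,\omega)\quad\text{on } Q\times\Omega,\qquad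 \|R_\eta\|_{L^\infty(Q\times\Omega)}\le C_R\,\eta^2\quad (0<|\eta|\le 1),$$ where $C_R$ is independent of $\eta$, $A_{\rm per}\in L^\infty(Q)^{d\times d}$ is $Q$-periodic and $A_1\in L^\infty(Q\times\Omega)^{d\times d}$ is stationary. **Lemma.** Suppose that $A_\eta$, $A_1$ and $A_{\rm per}$ are symmetric. Then: 1. For every $p\in\mathbb R^d$ there is a function $w^0_p\in H^1_{\rm per}(Q)$, unique up to an additive constant, such that $$\int_Q A_{\rm per}(p+\nabla w^0_p)\cdot\nabla\varphi=0\qquad\text{for all }\varphi\in H^1_{\rm per}(Q).$$ 2. For every $p\in\mathbb R^d$, almost surely, for every $N\in\mathbb N$ there is a function $w^{1,N}_p(\cdot,\omega)\in H^1_{\rm per}(Q_N)$, unique up to an additive constant, such that $$\int_{Q_N}A_{\rm per}\nabla w^{1,N}_p(\cdot,\omega)\cdot\nabla\varphi+\int_{Q_N}A_1(\cdot,\omega)(p+\nabla w^0_p)\cdot\nabla\varphi=0\qquad\text{for all }\varphi\in H^1_{\rm per}(Q_N).$$ 3. The random matrix $A^{\star,N}_1(\omega)$ defined by $$[A^{\star,N}_1]_{ij}(\omega)=\frac1{|Q_N|}\int_{Q_N}e_i^TA_{\rm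 per}\nabla w^{1,N}_{e_j}(\cdot,\omega)+\frac1{|Q_N|}\int_{Q_N}e_i^TA_1(\cdot,\omega)(\nabla w^0_{e_j}+e_j)$$ satisfies $$\lim_{N\to+\infty}A^{\star,N}_1(\omega)=A^\star_1\quad\text{almost surely},$$ where $A^\star_1$ is the deterministic matrix $$[A^\star_1]_{ij}=\int_Q(e_i+\nabla w^0_{e_i})^T\,\mathbb E(A_1)\,(e_j+\nabla w^0_{e_j}).$$ -/

import Mathlib

open MeasureTheory Filter Topology Matrix
open scoped ENNReal

noncomputable section

namespace PerturbedHomogenization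

/-- The space `ℝ^d` with its Euclidean norm and Lebesgue measure. -/
abbrev Space (d : ℕ) : Type := EuclideanSpace ℝ (Fin d)

/-- The cube `Q_N = [-N - 1/2, N + 1/2]^d`. The unit cell is `Q = Q_0`. -/
def cube (d N : ℕ) : Set (Space d) := {x | ∀ i, |x i| ≤ (N : ℝ) + 1 / 2}

/-- An integer vector seen in `ℝ^d`. -/
def latticeVec {d : ℕ} (k : Fin d → ℤ) : Space d := WithLp.toLp 2 fun i => (k i : ℝ)

/-- The canonical basis vector `e_i` of `ℝ^d`. -/
def basisVec {d : ℕ} (i : Fin d) : Space d := EuclideanSpace.single i (1 : ℝ)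

/-- The number `vᵀ A w`. -/
def form {d : ℕ} (A : Matrix (Fin d) (Fin d) ℝ) (v w : Space d) : ℝ :=
  v.ofLp ⬝ᵥ (A *ᵥ w.ofLp)

/-- `f` is `Q_N`-periodic (its periods are the vectors `(2N+1) k`, `k ∈ ℤ^d`), almost everywhere. -/
def PeriodicAE {d : ℕ} {F : Type*} (N : ℕ) (f : Space d → F) : Prop :=
  ∀ k : Fin d → ℤ, ∀ᵐ x, f (x + (2 * (N : ℝ) + 1) • latticeVec k) = f x

/-- `C^∞_per(Q_N)`: smooth `Q_N`-periodic functions on `ℝ^d`. -/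
def SmoothPeriodic {d : ℕ} (N : ℕ) (φ : Space d → ℝ) : Prop :=
  ContDiff ℝ (⊤ : ℕ∞) φ ∧
    ∀ (k : Fin d → ℤ) (x : Space d), φ (x + (2 * (N : ℝ) + 1) • latticeVec k) = φ x

/-- `H¹_per(Q_N)`, the closure of `C^∞_per(Q_N)` for the `H¹(Q_N)`-norm. An element is given by a
representative `toFun` and a representative `grad` of its gradient, both extended to `ℝ^d` by
periodicity; the field `approx` says that some sequence in `C^∞_per(Q_N)` converges to it for the
`H¹(Q_N)`-norm, so that `grad` is the weak gradient of `toFun`, determined by it almost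
everywhere. -/
structure H1Per (d N : ℕ) where
  toFun : Space d → ℝ
  grad : Space d → Space d
  memLp_toFun : MemLp toFun 2 (volume.restrict (cube d N))
  memLp_grad : MemLp grad 2 (volume.restrict (cube d N))
  periodic_toFun : PeriodicAE N toFun
  periodic_grad : PeriodicAE N grad
  approx : ∃ φ : ℕ → Space d → ℝ, (∀ n, SmoothPeriodic N (φ n)) ∧
    Tendsto (fun n => eLpNorm (fun x => φ n x - toFun x) 2 (volume.restrict (cube d N)))
      atTop (𝓝 0) ∧
    Tendsto (fun n => eLpNorm (fun x => gradient (φ n) x - grad x) 2 (volume.restrict (cube d N)))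
      atTop (𝓝 0)

/-- Equality of two elements of `H¹_per(Q_N)` up to the addition of a constant. -/
def H1Per.EqUpToConst {d N : ℕ} (w w' : H1Per d N) : Prop :=
  (∃ c : ℝ, ∀ᵐ x, w.toFun x = w'.toFun x + c) ∧ ∀ᵐ x, w.grad x = w'.grad x

/-- The norm of `(L^∞(μ))^{d × d}`: the largest of the essential suprema of the entries. -/
def linftyNorm {d : ℕ} {X : Type*} [MeasurableSpace X] (μ : Measure X)
    (A : X → Matrix (Fin d) (Fin d) ℝ) : ℝ≥0∞ :=
  ⨆ i, ⨆ j, eLpNorm (fun x => A x i j) ∞ μ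

/-- Entrywise (almost everywhere strong) measurability of a matrix field. -/
def AEMeasurableField {d : ℕ} {X : Type*} [MeasurableSpace X] (μ : Measure X)
    (A : X → Matrix (Fin d) (Fin d) ℝ) : Prop :=
  ∀ i j, AEStronglyMeasurable (fun x => A x i j) μ

/-- Discrete stationarity: for all `k ∈ ℤ^d`, `F (x + k, ω) = F (x, τ_k ω)` almost everywhere and
almost surely. The action `τ` of `ℤ^d` on `Ω` is written `+ᵥ`. -/
def Stationary {d : ℕ} {Ω F : Type*} [MeasurableSpace Ω] [AddAction (Fin d → ℤ) Ω]
    (P : Measure Ω) (f : Space d → Ω → F) : Prop :=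
  ∀ k : Fin d → ℤ, ∀ᵐ z ∂((volume : Measure (Space d)).prod P),
    f (z.1 + latticeVec k) z.2 = f z.1 (k +ᵥ z.2)

/-- Almost everywhere and almost sure symmetry of a random matrix field. -/
def SymmetricAE {d : ℕ} {Ω : Type*} [MeasurableSpace Ω] (P : Measure Ω)
    (A : Space d → Ω → Matrix (Fin d) (Fin d) ℝ) : Prop :=
  ∀ᵐ z ∂((volume : Measure (Space d)).prod P), (A z.1 z.2).IsSymm

/-- The weakly stochastic setting: for `|η| ≤ 1` the random matrix field `A_η` is measurable,
stationary, and bounded and coercive with constants that do not depend on `η`, and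
`A_η = A_per + η A_1 + O(η²)` in `(L^∞(Q × Ω))^{d × d}`, where `A_per ∈ (L^∞(Q))^{d × d}` is
`Q`-periodic and `A_1 ∈ (L^∞(Q × Ω))^{d × d}` is stationary. -/
structure WeaklyStochastic {d : ℕ} {Ω : Type*} [MeasurableSpace Ω] [AddAction (Fin d → ℤ) Ω]
    (P : Measure Ω) (A : ℝ → Space d → Ω → Matrix (Fin d) (Fin d) ℝ)
    (Aper : Space d → Matrix (Fin d) (Fin d) ℝ)
    (A₁ : Space d → Ω → Matrix (Fin d) (Fin d) ℝ) : Prop where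
  measurable_A : ∀ η : ℝ, |η| ≤ 1 →
    AEMeasurableField ((volume : Measure (Space d)).prod P) fun z => A η z.1 z.2
  stationary_A : ∀ η : ℝ, |η| ≤ 1 → Stationary P (A η)
  coercive_A : ∃ γ : ℝ, 0 < γ ∧ ∀ η : ℝ, |η| ≤ 1 → ∀ ξ : Space d,
    ∀ᵐ z ∂((volume : Measure (Space d)).prod P), γ * ‖ξ‖ ^ 2 ≤ form (A η z.1 z.2) ξ ξ
  bounded_A : ∃ M : ℝ, 0 < M ∧ ∀ η : ℝ, |η| ≤ 1 →
    linftyNorm ((volume : Measure (Space d)).prod P) (fun z => A η z.1 z.2) ≤ ENNReal.ofReal M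
  measurable_Aper : AEMeasurableField volume Aper
  periodic_Aper : PeriodicAE 0 Aper
  bounded_Aper : linftyNorm (volume.restrict (cube d 0)) Aper < ∞
  measurable_A₁ : AEMeasurableField ((volume : Measure (Space d)).prod P) fun z => A₁ z.1 z.2
  stationary_A₁ : Stationary P A₁
  bounded_A₁ : linftyNorm ((volume.restrict (cube d 0)).prod P) (fun z => A₁ z.1 z.2) < ∞
  expansion : ∃ C : ℝ, ∀ η : ℝ, η ≠ 0 → |η| ≤ 1 →
    linftyNorm ((volume.restrict (cube d 0)).prod P)
      (fun z => A η z.1 z.2 - Aper z.1 - η • A₁ z.1 z.2) ≤ ENNReal.ofReal (C * η ^ 2)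

/-- `w = w⁰_p` solves the periodic corrector problem:
`∫_Q A_per (p + ∇w) · ∇φ = 0` for all `φ ∈ H¹_per(Q)`. -/
def IsCorrectorZero {d : ℕ} (Aper : Space d → Matrix (Fin d) (Fin d) ℝ) (p : Space d)
    (w : H1Per d 0) : Prop :=
  ∀ φ : H1Per d 0, ∫ x in cube d 0, form (Aper x) (φ.grad x) (p + w.grad x) = 0

/-- `w = w^{1,N}_p(·, ω)` solves, for the realization `A₁ω = A_1(·, ω)`, the first order corrector
problem on `Q_N` that is associated with `w₀ = w⁰_p`:
`∫_{Q_N} A_per ∇w · ∇φ + ∫_{Q_N} A_1(·, ω) (p + ∇w⁰_p) · ∇φ = 0` for all `φ ∈ H¹_per(Q_N)`. -/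
def IsCorrectorOne {d : ℕ} (N : ℕ) (Aper A₁ω : Space d → Matrix (Fin d) (Fin d) ℝ) (p : Space d)
    (w₀ : H1Per d 0) (w : H1Per d N) : Prop :=
  ∀ φ : H1Per d N,
    (∫ x in cube d N, form (Aper x) (φ.grad x) (w.grad x)) +
      ∫ x in cube d N, form (A₁ω x) (φ.grad x) (p + w₀.grad x) = 0

/-- The matrix `A^{⋆,N}_1(ω)`, where `A₁ω = A_1(·, ω)`, `w₀ j = w⁰_{e_j}` and
`w₁ j = w^{1,N}_{e_j}(·, ω)`. -/
def firstOrderMatrix {d : ℕ} (N : ℕ) (Aper A₁ω : Space d → Matrix (Fin d) (Fin d) ℝ)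
    (w₀ : Fin d → H1Per d 0) (w₁ : Fin d → H1Per d N) : Matrix (Fin d) (Fin d) ℝ :=
  Matrix.of fun i j =>
    (volume.real (cube d N))⁻¹ *
        (∫ x in cube d N, form (Aper x) (basisVec i) ((w₁ j).grad x)) +
      (volume.real (cube d N))⁻¹ *
        ∫ x in cube d N, form (A₁ω x) (basisVec i) ((w₀ j).grad x + basisVec j)

/-- The matrix field `𝔼(A_1)`. -/
def expectation {d : ℕ} {Ω : Type*} [MeasurableSpace Ω] (P : Measure Ω)
    (A₁ : Space d → Ω → Matrix (Fin d) (Fin d) ℝ) (x : Space d) : Matrix (Fin d) (Fin d) ℝ :=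
  Matrix.of fun i j => ∫ ω, A₁ x ω i j ∂P

/-- The deterministic matrix `A^⋆_1`. -/
def limitMatrix {d : ℕ} {Ω : Type*} [MeasurableSpace Ω] (P : Measure Ω)
    (A₁ : Space d → Ω → Matrix (Fin d) (Fin d) ℝ) (w₀ : Fin d → H1Per d 0) :
    Matrix (Fin d) (Fin d) ℝ :=
  Matrix.of fun i j => ∫ x in cube d 0,
    form (expectation P A₁ x) (basisVec i + (w₀ i).grad x) (basisVec j + (w₀ j).grad x)

end PerturbedHomogenization

end

open PerturbedHomogenization

/-! For every `N` there is an exact identity: `A^{⋆,N}_1(ω)` is the mean over `Q_N` of `(e_i +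
∇w⁰_{e_i})ᵀ A_1(·, ω) (e_j + ∇w⁰_{e_j})`, so the correctors `w^{1,N}` drop out. It comes from
testing the equation of `w^{1,N}_{e_j}` with `w⁰_{e_i}` and the equation of `w⁰_{e_i}` with
`w^{1,N}_{e_j}`; symmetry of `A_per` makes the bilinear terms cancel (`firstOrderMatrix_apply`). The
second test needs the cell equation against `Q_N`-periodic functions, which is obtained by summing
the integer translates of the test function (`integral_inner_grad_eq_zero`).

Stationarity turns this mean into the average over `{-N, …, N}^d` of `X(τ_k ω)`, where `X` is the
integral over the unit cell (`integral_cube_form_eq_sum`). Since `X` is bounded, the pointwise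
ergodic theorem (`averageConverges_of_memLp_two`) gives the limit `𝔼 X`, and Fubini identifies it
with the entry of `A^⋆_1`. The ergodic theorem is proved classically: means converge for constants
and bounded coboundaries, ergodicity makes these span a dense subspace of `L²`, and the maximal
inequality (`maximal_inequality`, from a Vitali covering and transference to orbits) allows passing
to `L¹` limits.

Existence and uniqueness of the correctors follow from Lax-Milgram in the closed subspace of
gradients in `L²(Q_N)^d`; the Poincaré inequality recovers a function from its gradient
(`exists_h1Per_of_mem`). Coercivity of `A_per` is inherited from `A_η` as `η → 0`
(`coerciveField_Aper`). -/

noncomputable section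

namespace PerturbedHomogenization

/-! ### The pointwise ergodic theorem for `ℤ^d` on cubes -/

section ErgodicTheorem

/-- The discrete cube `{-N, …, N}^d`. -/
def box (d N : ℕ) : Finset (Fin d → ℤ) := Fintype.piFinset fun _ => Finset.Icc (-(N : ℤ)) N

variable {d : ℕ}

theorem mem_box {N : ℕ} {k : Fin d → ℤ} : k ∈ box d N ↔ ∀ i, |k i| ≤ N := by
  simp [box, abs_le]

theorem card_box (d N : ℕ) : (box d N).card = (2 * N + 1) ^ d := by
  simp only [box, Fintype.card_piFinset, Int.card_Icc, Finset.prod_const, Finset.card_univ,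
    Fintype.card_fin]
  congr 1
  omega

theorem add_mem_box {K N : ℕ} {k m : Fin d → ℤ} (hk : k ∈ box d K) (hm : m ∈ box d N) :
    k + m ∈ box d (K + N) := by
  rw [mem_box] at *
  intro i
  have := abs_add_le (k i) (m i)
  have := hk i
  have := hm i
  simp only [Pi.add_apply, Nat.cast_add]
  omega

theorem box_mono {K N : ℕ} (h : K ≤ N) : box d K ⊆ box d N := by
  intro k hk
  rw [mem_box] at *
  exact fun i => (hk i).trans (by exact_mod_cast h)

theorem exists_mem_box (k : Fin d → ℤ) : ∃ K, k ∈ box d K := by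
  refine ⟨∑ i, (k i).natAbs, mem_box.2 fun i => ?_⟩
  have := Finset.single_le_sum (f := fun i => (k i).natAbs) (fun _ _ => Nat.zero_le _)
    (Finset.mem_univ i)
  rw [Int.abs_eq_natAbs]
  exact_mod_cast this

/-- A covering argument of Vitali type: centres of cubes on which the mean of `g` is large. -/
theorem card_mul_le_of_large_means (S T : Finset (Fin d → ℤ)) (r : (Fin d → ℤ) → ℕ)
    (g : (Fin d → ℤ) → ℝ) (hg : ∀ m, 0 ≤ g m) {c : ℝ}
    (hS : ∀ k ∈ S, c * (2 * (r k : ℝ) + 1) ^ d ≤ ∑ m ∈ box d (r k), g (m + k))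
    (hc : 0 ≤ c) (hT : ∀ k ∈ S, ∀ m ∈ box d (r k), m + k ∈ T) :
    c * S.card ≤ 3 ^ d * ∑ m ∈ T, g m := by
  classical
  set B : (Fin d → ℤ) → Finset (Fin d → ℤ) := fun k => (box d (r k)).map (addRightEmbedding k)
    with hB
  have hmemB : ∀ k x, x ∈ B k ↔ ∀ i, |x i - k i| ≤ r k := by
    intro k x
    simp only [hB, Finset.mem_map, mem_box, addRightEmbedding_apply]
    constructor
    · rintro ⟨a, ha, rfl⟩ i
      simpa using ha i
    · intro h
      exact ⟨x - k, by simpa using h, by simp⟩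
  -- With ratio 2, each cube `B a` meets a selected `B b` with `r a ≤ 2 * r b`. Only the centres
  -- have to be covered, and `|a - b| ≤ r a + r b ≤ 3 * r b`, whence the factor 3.
  obtain ⟨u, huS, hdisj, hu⟩ := Vitali.exists_disjoint_subfamily_covering_enlargement
    (fun k => (B k : Set (Fin d → ℤ))) (S : Set (Fin d → ℤ)) (fun k => (r k : ℝ)) 2 one_lt_two
    (fun _ _ => Nat.cast_nonneg _) (∑ k ∈ S, (r k : ℝ))
    (fun a ha => Finset.single_le_sum (f := fun k => (r k : ℝ)) (fun _ _ => Nat.cast_nonneg _) ha)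
    (fun a _ => ⟨a, by simp [hmemB]⟩)
  have hufin : u.Finite := S.finite_toSet.subset huS
  lift u to Finset (Fin d → ℤ) using hufin
  have hcover : S ⊆ u.biUnion fun b => (box d (3 * r b)).map (addRightEmbedding b) := by
    intro a ha
    obtain ⟨b, hb, ⟨x, hxa, hxb⟩, hr⟩ := hu a ha
    simp only [Finset.mem_coe, hmemB] at hxa hxb
    have hr' : r a ≤ 2 * r b := by exact_mod_cast hr
    simp only [Finset.mem_biUnion, Finset.mem_map, mem_box, addRightEmbedding_apply]
    refine ⟨b, hb, a - b, fun i => ?_, by simp⟩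
    have h1 := hxa i
    have h2 := hxb i
    rw [abs_le] at h1 h2 ⊢
    simp only [Pi.sub_apply, Nat.cast_mul, Nat.cast_ofNat]
    omega
  have hcard : (S.card : ℝ) ≤ ∑ b ∈ u, 3 ^ d * (2 * (r b : ℝ) + 1) ^ d := by
    have h1 : S.card ≤ ∑ b ∈ u, (2 * (3 * r b) + 1) ^ d :=
      (Finset.card_le_card hcover).trans (Finset.card_biUnion_le.trans (by simp [card_box]))
    calc (S.card : ℝ) ≤ ((∑ b ∈ u, (2 * (3 * r b) + 1) ^ d : ℕ) : ℝ) := by exact_mod_cast h1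
      _ = ∑ b ∈ u, (2 * (3 * (r b : ℝ)) + 1) ^ d := by push_cast; rfl
      _ ≤ _ := Finset.sum_le_sum fun b _ => by
          rw [← mul_pow]
          gcongr
          linarith
  calc c * S.card ≤ c * ∑ b ∈ u, 3 ^ d * (2 * (r b : ℝ) + 1) ^ d := by gcongr
    _ = 3 ^ d * ∑ b ∈ u, c * (2 * (r b : ℝ) + 1) ^ d := by
        rw [← Finset.mul_sum, ← Finset.mul_sum]; ring
    _ ≤ 3 ^ d * ∑ b ∈ u, ∑ m ∈ B b, g m := by
        gcongr with b hb
        simpa [hB] using hS b (huS hb)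
    _ = 3 ^ d * ∑ m ∈ u.biUnion B, g m := by
        rw [Finset.sum_biUnion]
        intro a ha b hb hab
        exact Finset.disjoint_coe.1 (hdisj ha hb hab)
    _ ≤ 3 ^ d * ∑ m ∈ T, g m := by
        gcongr
        · exact fun _ _ _ => hg _
        · intro x hx
          simp only [Finset.mem_biUnion, hB, Finset.mem_map, addRightEmbedding_apply] at hx
          obtain ⟨b, hb, m, hm, rfl⟩ := hx
          exact hT b (huS hb) m hm

/-- The Følner property of cubes: enlarging by a fixed `K` adds a negligible proportion of points.
-/
theorem tendsto_box_ratio (d K : ℕ) :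
    Tendsto (fun L : ℕ => ((2 * ((L : ℝ) + K) + 1) ^ d / (2 * (L : ℝ) + 1) ^ d)) atTop (𝓝 1) := by
  have h1 : Tendsto (fun L : ℕ => 2 * (L : ℝ) + 1) atTop atTop :=
    tendsto_atTop_add_const_right _ _ (tendsto_natCast_atTop_atTop.const_mul_atTop two_pos)
  have h2 : Tendsto (fun L : ℕ => (1 + 2 * (K : ℝ) / (2 * (L : ℝ) + 1)) ^ d) atTop (𝓝 1) := by
    simpa using ((h1.const_div_atTop (2 * (K : ℝ))).const_add 1).pow d
  refine h2.congr fun L => ?_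
  rw [← div_pow]
  congr 1
  have : (2 * (L : ℝ) + 1) ≠ 0 := by positivity
  field_simp
  ring

variable {Ω : Type*} [AddAction (Fin d → ℤ) Ω]

/-- The mean of `f` along the orbit of `ω` over the discrete cube `{-N, …, N}^d`. -/
def boxAverage (f : Ω → ℝ) (N : ℕ) (ω : Ω) : ℝ :=
  ((2 * (N : ℝ) + 1) ^ d)⁻¹ * ∑ k ∈ box d N, f (k +ᵥ ω)

theorem boxAverage_const (c : ℝ) (N : ℕ) (ω : Ω) :
    boxAverage (d := d) (fun _ => c) N ω = c := by
  have : (2 * (N : ℝ) + 1) ^ d ≠ 0 := by positivity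
  simp [boxAverage, card_box, this]

theorem boxAverage_add (f g : Ω → ℝ) (N : ℕ) (ω : Ω) :
    boxAverage (d := d) (fun ω => f ω + g ω) N ω =
      boxAverage (d := d) f N ω + boxAverage (d := d) g N ω := by
  simp [boxAverage, Finset.sum_add_distrib, mul_add]

theorem boxAverage_sub (f g : Ω → ℝ) (N : ℕ) (ω : Ω) :
    boxAverage (d := d) (fun ω => f ω - g ω) N ω =
      boxAverage (d := d) f N ω - boxAverage (d := d) g N ω := by
  simp [boxAverage, Finset.sum_sub_distrib, mul_sub]

theorem boxAverage_const_mul (c : ℝ) (f : Ω → ℝ) (N : ℕ) (ω : Ω) :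
    boxAverage (d := d) (fun ω => c * f ω) N ω = c * boxAverage (d := d) f N ω := by
  simp only [boxAverage, ← Finset.mul_sum]
  ring

theorem abs_boxAverage_le (f : Ω → ℝ) (N : ℕ) (ω : Ω) :
    |boxAverage (d := d) f N ω| ≤ boxAverage (d := d) (fun ω => |f ω|) N ω := by
  unfold boxAverage
  rw [abs_mul, abs_of_nonneg (by positivity)]
  gcongr
  exact Finset.abs_sum_le_sum_abs _ _

/-- The means of a bounded coboundary tend to zero. -/
theorem tendsto_boxAverage_coboundary {g : Ω → ℝ} {C : ℝ} (hg : ∀ ω, |g ω| ≤ C) (k : Fin d → ℤ)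
    (ω : Ω) : Tendsto (fun N => boxAverage (d := d) (fun ω => g (k +ᵥ ω) - g ω) N ω) atTop (𝓝 0) := by
  classical
  obtain ⟨K, hK⟩ := exists_mem_box k
  have hC : 0 ≤ C := (abs_nonneg _).trans (hg ω)
  have key : ∀ N, |boxAverage (d := d) (fun ω => g (k +ᵥ ω) - g ω) N ω| ≤
      2 * C * ((2 * ((N : ℝ) + K) + 1) ^ d / (2 * (N : ℝ) + 1) ^ d - 1) := by
    intro N
    have hpos : 0 < (2 * (N : ℝ) + 1) ^ d := by positivity
    set S := (box d N).map (addRightEmbedding k) with hS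
    have hsub : S ⊆ box d (N + K) := by
      intro x hx
      simp only [hS, Finset.mem_map, addRightEmbedding_apply] at hx
      obtain ⟨m, hm, rfl⟩ := hx
      exact add_mem_box hm hK
    have hsub' : box d N ⊆ box d (N + K) := box_mono (Nat.le_add_right _ _)
    have hcardS : S.card = (box d N).card := Finset.card_map _
    -- The box and its translate by `k` have the same cardinality and lie in the same larger box, so
    -- each sum misses the large one by a boundary term. Comparing both with it gives the factor 2.
    have hdiff : ∀ U ⊆ box d (N + K), U.card = (box d N).card →
        |∑ m ∈ box d (N + K), g (m +ᵥ ω) - ∑ m ∈ U, g (m +ᵥ ω)| ≤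
          C * ((2 * ((N : ℝ) + K) + 1) ^ d - (2 * (N : ℝ) + 1) ^ d) := by
      intro U hU hcU
      rw [← Finset.sum_sdiff hU, add_sub_cancel_right]
      refine (Finset.abs_sum_le_sum_abs _ _).trans ?_
      refine (Finset.sum_le_sum fun m _ => hg (m +ᵥ ω)).trans ?_
      rw [Finset.sum_const, nsmul_eq_mul, Finset.cast_card_sdiff hU, hcU, card_box, card_box]
      push_cast
      linarith
    have h1 := hdiff S hsub hcardS
    have h2 := hdiff (box d N) hsub' rfl
    have hsum : ∑ m ∈ box d N, (g (k +ᵥ (m +ᵥ ω)) - g (m +ᵥ ω)) =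
        ∑ m ∈ S, g (m +ᵥ ω) - ∑ m ∈ box d N, g (m +ᵥ ω) := by
      rw [Finset.sum_sub_distrib, hS, Finset.sum_map]
      congr 1
      refine Finset.sum_congr rfl fun m _ => ?_
      rw [vadd_vadd, addRightEmbedding_apply, add_comm]
    rw [boxAverage, hsum, abs_mul, abs_of_nonneg (by positivity), div_sub_one hpos.ne',
      inv_mul_eq_div, ← mul_div_assoc]
    gcongr
    rw [abs_le] at *
    constructor <;> linarith
  refine squeeze_zero_norm key ?_
  have := ((tendsto_box_ratio d K).sub_const 1).const_mul (2 * C)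
  simpa using this

variable [MeasurableSpace Ω] {P : Measure Ω} [IsProbabilityMeasure P]
  [MeasurableConstVAdd (Fin d → ℤ) Ω]

theorem measurable_boxAverage {f : Ω → ℝ} (hf : Measurable f) (N : ℕ) :
    Measurable (boxAverage (d := d) f N) := by
  unfold boxAverage
  refine Measurable.const_mul (Finset.measurable_sum _ fun k _ => ?_) _
  exact hf.comp (measurable_const_vadd k)

/-- The weak type maximal inequality for means over discrete cubes. -/
theorem maximal_inequality [VAddInvariantMeasure (Fin d → ℤ) Ω P] {f : Ω → ℝ} (hf : Measurable f)
    (hfi : Integrable f P) (hf0 : ∀ ω, 0 ≤ f ω) {c : ℝ} (hc : 0 ≤ c) :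
    c * P.real {ω | ∃ N, c ≤ boxAverage (d := d) f N ω} ≤ 3 ^ d * ∫ ω, f ω ∂P := by
  classical
  -- Truncating the radii at `K` keeps every cube centred in `box d L` inside `box d (L + K)`; the
  -- truncation is removed at the end by monotone convergence.
  set E : ℕ → Set Ω := fun K => {ω | ∃ N ≤ K, c ≤ boxAverage (d := d) f N ω} with hE
  have hEm : ∀ K, MeasurableSet (E K) := by
    intro K
    have : E K = ⋃ N ∈ Set.Iic K, {ω | c ≤ boxAverage (d := d) f N ω} := by
      ext ω; simp [hE]
    rw [this]
    exact MeasurableSet.biUnion (Set.to_countable _) fun N _ =>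
      measurableSet_le measurable_const (measurable_boxAverage hf N)
  have hfk : ∀ k : Fin d → ℤ, Integrable (fun ω => f (k +ᵥ ω)) P := fun k =>
    (measurePreserving_vadd k P).integrable_comp_of_integrable hfi
  have hint : ∀ k : Fin d → ℤ, ∫ ω, f (k +ᵥ ω) ∂P = ∫ ω, f ω ∂P := fun k =>
    (measurePreserving_vadd k P).integral_comp (measurableEmbedding_const_vadd k) f
  have hIi : ∀ (K : ℕ), Integrable ((E K).indicator fun _ => (1 : ℝ)) P := fun K =>
    (integrable_const 1).indicator (hEm K)
  have hIk : ∀ (K : ℕ) (k : Fin d → ℤ),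
      Integrable (fun ω => (E K).indicator (fun _ => (1 : ℝ)) (k +ᵥ ω)) P := fun K k =>
    (measurePreserving_vadd k P).integrable_comp_of_integrable (hIi K)
  have hIint : ∀ (K : ℕ) (k : Fin d → ℤ),
      ∫ ω, (E K).indicator (fun _ => (1 : ℝ)) (k +ᵥ ω) ∂P = P.real (E K) := by
    intro K k
    rw [(measurePreserving_vadd k P).integral_comp (measurableEmbedding_const_vadd k)
      ((E K).indicator fun _ => (1 : ℝ)), integral_indicator_const _ (hEm K)]
    simp
  -- Transference: the covering lemma is applied to `m ↦ f (m +ᵥ ω)` on the orbit of each `ω`, then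
  -- integrated. Invariance of `P` makes every term of the sums contribute equally.
  have step : ∀ K L : ℕ, c * P.real (E K) * (2 * (L : ℝ) + 1) ^ d ≤
      3 ^ d * ((2 * ((L : ℝ) + K) + 1) ^ d * ∫ ω, f ω ∂P) := by
    intro K L
    have hpt : ∀ ω, c * ∑ k ∈ box d L, (E K).indicator (fun _ => (1 : ℝ)) (k +ᵥ ω) ≤
        3 ^ d * ∑ m ∈ box d (L + K), f (m +ᵥ ω) := by
      intro ω
      set S := (box d L).filter fun k => k +ᵥ ω ∈ E K with hS
      have hsum : ∑ k ∈ box d L, (E K).indicator (fun _ => (1 : ℝ)) (k +ᵥ ω) = S.card := by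
        rw [hS, Finset.card_filter]
        push_cast
        exact Finset.sum_congr rfl fun x _ => by rw [Set.indicator_apply]
      rw [hsum]
      have hex : ∀ k : Fin d → ℤ, ∃ N ≤ K, k ∈ S → c ≤ boxAverage (d := d) f N (k +ᵥ ω) := by
        intro k
        by_cases hk : k ∈ S
        · obtain ⟨N, hN, h⟩ := (Finset.mem_filter.1 hk).2
          exact ⟨N, hN, fun _ => h⟩
        · exact ⟨0, Nat.zero_le _, fun h => (hk h).elim⟩
      choose r hrK hr using hex
      refine card_mul_le_of_large_means S (box d (L + K)) r (fun m => f (m +ᵥ ω))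
        (fun m => hf0 _) ?_ hc ?_
      · intro k hk
        have := hr k hk
        rw [boxAverage, inv_mul_eq_div, le_div_iff₀ (by positivity)] at this
        simpa [vadd_vadd] using this
      · intro k hk m hm
        rw [add_comm m k]
        exact add_mem_box (Finset.mem_filter.1 hk).1 (box_mono (hrK k) hm)
    have := integral_mono
      ((integrable_finsetSum (box d L) fun k _ => hIk K k).const_mul c)
      ((integrable_finsetSum (box d (L + K)) fun m _ => hfk m).const_mul (3 ^ d)) hpt
    rw [integral_const_mul, integral_const_mul, integral_finsetSum _ fun k _ => hIk K k,
      integral_finsetSum _ fun m _ => hfk m] at this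
    simp only [hIint, hint, Finset.sum_const, card_box, nsmul_eq_mul] at this
    push_cast at this
    linarith
  -- For fixed `K`, divide by the volume of `box d L` and let `L → ∞`.
  have hK : ∀ K, c * P.real (E K) ≤ 3 ^ d * ∫ ω, f ω ∂P := by
    intro K
    have hlim := ((tendsto_box_ratio d K).const_mul (3 ^ d * ∫ ω, f ω ∂P))
    rw [mul_one] at hlim
    refine ge_of_tendsto' hlim fun L => ?_
    have hpos : 0 < (2 * (L : ℝ) + 1) ^ d := by positivity
    rw [← mul_div_assoc, le_div_iff₀ hpos]
    linarith [step K L]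
  have hmono : Monotone E := fun K K' h ω ⟨N, hN, h'⟩ => ⟨N, hN.trans h, h'⟩
  have hU : {ω | ∃ N, c ≤ boxAverage (d := d) f N ω} = ⋃ K, E K := by
    ext ω
    simp only [hE, Set.mem_ofPred_eq, Set.mem_iUnion]
    exact ⟨fun ⟨N, h⟩ => ⟨N, N, le_rfl, h⟩, fun ⟨_, N, _, h⟩ => ⟨N, h⟩⟩
  have ht : Tendsto (fun K => P.real (E K)) atTop (𝓝 (P.real (⋃ K, E K))) :=
    (ENNReal.tendsto_toReal (measure_ne_top _ _)).comp (tendsto_measure_iUnion_atTop hmono)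
  rw [hU]
  exact le_of_tendsto' (ht.const_mul c) hK

/-- The means of `f` over discrete cubes converge almost surely to its integral. -/
def AverageConverges (P : Measure Ω) (f : Ω → ℝ) : Prop :=
  ∀ᵐ ω ∂P, Tendsto (fun N => boxAverage (d := d) f N ω) atTop (𝓝 (∫ ω, f ω ∂P))

omit [IsProbabilityMeasure P] in
theorem AverageConverges.congr_ae [VAddInvariantMeasure (Fin d → ℤ) Ω P] {f g : Ω → ℝ}
    (hf : AverageConverges (d := d) P f) (hfg : f =ᵐ[P] g) : AverageConverges (d := d) P g := by
  have hk : ∀ᵐ ω ∂P, ∀ k : Fin d → ℤ, f (k +ᵥ ω) = g (k +ᵥ ω) :=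
    ae_all_iff.2 fun k => (measurePreserving_vadd k P).quasiMeasurePreserving.ae hfg
  filter_upwards [hf, hk] with ω h1 h2
  rw [← integral_congr_ae hfg]
  simpa only [boxAverage, h2] using h1

/-- The set of functions whose means converge almost surely is closed in `L¹`. -/
theorem AverageConverges.of_approx [VAddInvariantMeasure (Fin d → ℤ) Ω P] {f : Ω → ℝ}
    (hf : Measurable f) (hfi : Integrable f P)
    (h : ∀ ε > 0, ∃ g : Ω → ℝ, Measurable g ∧ Integrable g P ∧ AverageConverges (d := d) P g ∧
      ∫ ω, |f ω - g ω| ∂P ≤ ε) : AverageConverges (d := d) P f := by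
  have key : ∀ δ > 0, ∀ᵐ ω ∂P, ∀ᶠ N in atTop,
      |boxAverage (d := d) f N ω - ∫ ω, f ω ∂P| ≤ δ := by
    intro δ hδ
    rw [ae_iff, ← measureReal_eq_zero_iff]
    refine le_antisymm (le_of_forall_pos_le_add fun ε hε => ?_) measureReal_nonneg
    rw [zero_add]
    -- The first bound controls the difference of the integrals, the second one makes the
    -- exceptional set of the maximal inequality at level `δ / 3` have measure at most `ε`.
    obtain ⟨g, hg, hgi, hgc, hfg⟩ := h (min (δ / 3) (ε * (δ / 3) / 3 ^ d)) (by positivity)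
    set B := {ω | ∃ N, δ / 3 ≤ boxAverage (d := d) (fun ω => |f ω - g ω|) N ω} with hB
    have hmax : δ / 3 * P.real B ≤ 3 ^ d * ∫ ω, |f ω - g ω| ∂P :=
      maximal_inequality (hf.sub hg).abs (hfi.sub hgi).abs (fun ω => abs_nonneg _) (by positivity)
    have hBε : P.real B ≤ ε := by
      have h1 : ∫ ω, |f ω - g ω| ∂P ≤ ε * (δ / 3) / 3 ^ d := hfg.trans (min_le_right _ _)
      rw [le_div_iff₀ (by positivity)] at h1
      have h2 : (δ / 3) * P.real B ≤ (δ / 3) * ε := by linarith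
      exact le_of_mul_le_mul_left h2 (by positivity)
    refine le_trans ?_ hBε
    refine ENNReal.toReal_mono (measure_ne_top _ _) (measure_mono_ae ?_)
    filter_upwards [hgc] with ω hω hbad
    by_contra hnB
    refine hbad ?_
    have hnB' : ∀ N, boxAverage (d := d) (fun ω => |f ω - g ω|) N ω < δ / 3 := by
      intro N
      by_contra hN
      exact hnB ⟨N, not_lt.1 hN⟩
    have hev := (Metric.tendsto_nhds.1 hω) (δ / 3) (by positivity)
    filter_upwards [hev] with N hN
    rw [Real.dist_eq] at hN
    have h1 := abs_boxAverage_le (d := d) (fun ω => f ω - g ω) N ω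
    rw [boxAverage_sub] at h1
    have h2 := hnB' N
    have h3 : |∫ ω, g ω ∂P - ∫ ω, f ω ∂P| ≤ δ / 3 := by
      rw [abs_sub_comm, ← integral_sub hfi hgi]
      exact (abs_integral_le_integral_abs).trans (hfg.trans (min_le_left _ _))
    rw [abs_le] at *
    rw [abs_lt] at hN
    constructor <;> linarith
  have hall : ∀ᵐ ω ∂P, ∀ n : ℕ, ∀ᶠ N in atTop,
      |boxAverage (d := d) f N ω - ∫ ω, f ω ∂P| ≤ 1 / ((n : ℝ) + 1) :=
    ae_all_iff.2 fun n => key _ (by positivity)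
  filter_upwards [hall] with ω hω
  rw [Metric.tendsto_nhds]
  intro ε hε
  obtain ⟨n, hn⟩ := exists_nat_one_div_lt hε
  filter_upwards [hω n] with N hN
  rw [Real.dist_eq]
  exact hN.trans_lt hn

theorem measurable_indicator_one {s : Set Ω} (hs : MeasurableSet s) :
    Measurable (s.indicator fun _ => (1 : ℝ)) := measurable_const.indicator hs

/-- The sums telescope up to boundary terms, and the integral vanishes by invariance. Coboundaries
of indicators are enough test functions to detect invariance of an `L²` function. -/
theorem averageConverges_coboundary [VAddInvariantMeasure (Fin d → ℤ) Ω P] {s : Set Ω}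
    (hs : MeasurableSet s) (k : Fin d → ℤ) :
    AverageConverges (d := d) P fun ω =>
      s.indicator (fun _ => (1 : ℝ)) (k +ᵥ ω) - s.indicator (fun _ => (1 : ℝ)) ω := by
  have hi : Integrable (s.indicator fun _ => (1 : ℝ)) P := (integrable_const 1).indicator hs
  have hk : Integrable (fun ω => s.indicator (fun _ => (1 : ℝ)) (k +ᵥ ω)) P :=
    (measurePreserving_vadd k P).integrable_comp_of_integrable hi
  have h0 : ∫ ω, (s.indicator (fun _ => (1 : ℝ)) (k +ᵥ ω) - s.indicator (fun _ => (1 : ℝ)) ω) ∂P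
      = 0 := by
    rw [integral_sub hk hi, (measurePreserving_vadd k P).integral_comp
      (measurableEmbedding_const_vadd k) (s.indicator fun _ => (1 : ℝ)), sub_self]
  rw [AverageConverges, h0]
  refine Eventually.of_forall fun ω => tendsto_boxAverage_coboundary (C := 1) (fun ω => ?_) k ω
  by_cases h : ω ∈ s <;> simp [h]

/-- A square integrable function of mean zero that is orthogonal to all coboundaries of
indicator functions vanishes. -/
theorem ae_eq_zero_of_orthogonal_coboundaries [ErgodicVAdd (Fin d → ℤ) Ω P] {h : Ω → ℝ}
    (hm : Measurable h) (hi : Integrable h P) (h0 : ∫ ω, h ω ∂P = 0)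
    (hinv : ∀ (k : Fin d → ℤ) (s : Set Ω), MeasurableSet s →
      ∫ ω in (k +ᵥ ·) ⁻¹' s, h ω ∂P = ∫ ω in s, h ω ∂P) : h =ᵐ[P] 0 := by
  -- Orthogonality to the coboundaries says that `h` and its translate have the same integral over
  -- every measurable set, so `h` is invariant.
  have hk : ∀ k : Fin d → ℤ, (fun ω => h (k +ᵥ ω)) =ᵐ[P] h := by
    intro k
    have hik : Integrable (fun ω => h (k +ᵥ ω)) P :=
      (measurePreserving_vadd k P).integrable_comp_of_integrable hi
    refine hik.ae_eq_of_forall_setIntegral_eq _ _ hi fun s hs _ => ?_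
    have hs' : s = (k +ᵥ ·) ⁻¹' ((-k +ᵥ ·) ⁻¹' s) := by
      ext ω
      simp
    have hm' : MeasurableSet ((-k +ᵥ ·) ⁻¹' s : Set Ω) := measurable_const_vadd (-k) hs
    rw [hs', hinv k _ hm', (measurePreserving_vadd k P).setIntegral_preimage_emb
      (measurableEmbedding_const_vadd k)]
  have hs : MeasurableSet {ω | 0 < h ω} := measurableSet_lt measurable_const hm
  -- Ergodicity is needed for this one set: it is null or conull, so `h` has a constant sign, and
  -- its zero mean does the rest.
  have hc : EventuallyConst {ω | 0 < h ω} (ae P) := by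
    refine aeconst_of_forall_preimage_vadd_ae_eq (Fin d → ℤ) hs.nullMeasurableSet fun k => ?_
    refine eventuallyEq_set.2 ?_
    filter_upwards [hk k] with ω hω
    simp only [Set.mem_preimage, Set.mem_ofPred_eq, hω]
  rcases eventuallyConst_set.1 hc with hpos | hneg
  · exfalso
    have := (integral_pos_iff_support_of_nonneg_ae (hpos.mono fun ω hω => le_of_lt hω) hi).2 ?_
    · exact this.ne' h0
    · have hsupp : (Function.support h) =ᵐ[P] Set.univ := by
        refine eventuallyEq_set.2 ?_
        filter_upwards [hpos] with ω hω
        simpa using (ne_of_gt hω)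
      rw [measure_congr hsupp]
      simp
  · have hle : 0 ≤ᵐ[P] fun ω => -h ω := by
      filter_upwards [hneg] with ω hω
      simpa using hω
    have := (integral_eq_zero_iff_of_nonneg_ae hle hi.neg).1 (by rw [integral_neg, h0, neg_zero])
    filter_upwards [this] with ω hω
    simpa using hω

/-- The pointwise ergodic theorem for an ergodic action of `ℤ^d`, for means over cubes. -/
theorem averageConverges_of_memLp_two [ErgodicVAdd (Fin d → ℤ) Ω P] {f : Ω → ℝ}
    (hf : MemLp f 2 P) : AverageConverges (d := d) P f := by
  set G : Set (Lp ℝ 2 P) :=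
    {F | ∃ g : Ω → ℝ, Measurable g ∧ AverageConverges (d := d) P g ∧ F =ᵐ[P] g} with hG
  let S : Submodule ℝ (Lp ℝ 2 P) :=
    { carrier := G
      zero_mem' := ⟨fun _ => 0, measurable_const, by
        refine Eventually.of_forall fun ω => ?_
        simp [boxAverage], Lp.coeFn_zero _ _ _⟩
      add_mem' := by
        rintro F₁ F₂ ⟨g₁, hm₁, hc₁, he₁⟩ ⟨g₂, hm₂, hc₂, he₂⟩
        have hi₁ : Integrable g₁ P :=
          ((Lp.memLp F₁).integrable one_le_two).congr he₁
        have hi₂ : Integrable g₂ P :=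
          ((Lp.memLp F₂).integrable one_le_two).congr he₂
        refine ⟨fun ω => g₁ ω + g₂ ω, hm₁.add hm₂, ?_, ?_⟩
        · filter_upwards [hc₁, hc₂] with ω h1 h2
          rw [integral_add hi₁ hi₂]
          simpa only [boxAverage_add] using h1.add h2
        · filter_upwards [Lp.coeFn_add F₁ F₂, he₁, he₂] with ω h1 h2 h3
          rw [h1, Pi.add_apply, h2, h3]
      smul_mem' := by
        rintro c F ⟨g, hm, hc, he⟩
        refine ⟨fun ω => c * g ω, hm.const_mul c, ?_, ?_⟩
        · filter_upwards [hc] with ω h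
          rw [integral_const_mul]
          simpa only [boxAverage_const_mul] using h.const_mul c
        · filter_upwards [Lp.coeFn_smul c F, he] with ω h1 h2
          rw [h1, Pi.smul_apply, h2, smul_eq_mul] }
  -- An `H` orthogonal to all good functions is orthogonal to the constants, hence has mean zero,
  -- and to the coboundaries of indicators.
  have hS : Sᗮ = ⊥ := by
    rw [Submodule.eq_bot_iff]
    intro H hH
    rw [Submodule.mem_orthogonal] at hH
    have hHi : Integrable H P := (Lp.memLp H).integrable one_le_two
    have hHm : Measurable H := (Lp.stronglyMeasurable H).measurable
    have hinner : ∀ g : Ω → ℝ, Measurable g → MemLp g 2 P → AverageConverges (d := d) P g →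
        ∫ ω, g ω * H ω ∂P = 0 := by
      intro g hm hg hgc
      have h1 := hH (hg.toLp g) ⟨g, hm, hgc, hg.coeFn_toLp⟩
      rw [L2.inner_def] at h1
      rw [← h1]
      refine integral_congr_ae ?_
      filter_upwards [hg.coeFn_toLp] with ω h2
      rw [h2]
      simp [mul_comm]
    have h0 : ∫ ω, H ω ∂P = 0 := by
      have := hinner (fun _ => 1) measurable_const (memLp_const 1)
        (Eventually.of_forall fun ω => by simp [boxAverage_const])
      simpa using this
    refine (Lp.eq_zero_iff_ae_eq_zero).2
      (ae_eq_zero_of_orthogonal_coboundaries (d := d) hHm hHi h0 fun k s hs => ?_)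
    have hms : MeasurableSet ((k +ᵥ ·) ⁻¹' s : Set Ω) := measurable_const_vadd k hs
    have hmem : ∀ {t : Set Ω}, MeasurableSet t → MemLp (t.indicator fun _ => (1 : ℝ)) 2 P :=
      fun ht => (memLp_const 1).indicator ht
    have := hinner _ (((measurable_indicator_one hs).comp (measurable_const_vadd k)).sub
      (measurable_indicator_one hs)) ((hmem hms).sub (hmem hs)) (averageConverges_coboundary hs k)
    change ∫ ω, (s.indicator (fun _ => (1 : ℝ)) (k +ᵥ ω) - s.indicator (fun _ => (1 : ℝ)) ω) *
        H ω ∂P = 0 at this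
    have hexp : ∀ ω, (s.indicator (fun _ => (1 : ℝ)) (k +ᵥ ω) - s.indicator (fun _ => (1 : ℝ)) ω) *
        H ω = ((k +ᵥ ·) ⁻¹' s).indicator H ω - s.indicator H ω := by
      intro ω
      by_cases h1 : k +ᵥ ω ∈ s <;> by_cases h2 : ω ∈ s <;> simp [h1, h2]
    simp only [hexp] at this
    rw [integral_sub (hHi.indicator hms) (hHi.indicator hs), integral_indicator hms,
      integral_indicator hs] at this
    linarith
  have hdense : S.topologicalClosure = ⊤ := Submodule.topologicalClosure_eq_top_iff.2 hS
  obtain ⟨f', hf'm, hff'⟩ := hf.1.aemeasurable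
  refine AverageConverges.congr_ae ?_ hff'.symm
  have hf' : MemLp f' 2 P := hf.ae_eq hff'
  -- Density holds in `L²`; on a probability space it gives the `L¹` approximation required here.
  refine AverageConverges.of_approx hf'm (hf'.integrable one_le_two) fun ε hε => ?_
  have hmem : hf'.toLp f' ∈ closure (S : Set (Lp ℝ 2 P)) := by
    rw [← Submodule.topologicalClosure_coe, hdense]
    trivial
  obtain ⟨F, ⟨g, hm, hgc, hFg⟩, hd⟩ := Metric.mem_closure_iff.1 hmem ε hε
  have hg : MemLp g 2 P := (Lp.memLp F).ae_eq hFg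
  refine ⟨g, hm, hg.integrable one_le_two, hgc, ?_⟩
  have hFeq : F = hg.toLp g := by
    rw [← Lp.toLp_coeFn F (Lp.memLp F)]
    exact (MemLp.toLp_eq_toLp_iff _ _).2 hFg
  have hsub : MemLp (f' - g) 2 P := hf'.sub hg
  rw [hFeq, Lp.dist_edist, Lp.edist_toLp_toLp] at hd
  have h1 : ∫ ω, |f' ω - g ω| ∂P = (eLpNorm (f' - g) 1 P).toReal := by
    rw [eLpNorm_one_eq_lintegral_enorm, ← integral_norm_eq_lintegral_enorm hsub.1]
    rfl
  rw [h1]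
  refine le_trans ?_ hd.le
  exact ENNReal.toReal_mono hsub.2.ne (eLpNorm_le_eLpNorm_of_exponent_le one_le_two hsub.1)

end ErgodicTheorem

/-! ### Cubes, tilings and periodic functions -/

section Cubes

variable {d : ℕ} {F : Type*}

@[simp] theorem latticeVec_apply (k : Fin d → ℤ) (i : Fin d) : latticeVec k i = (k i : ℝ) := rfl

theorem latticeVec_add (k m : Fin d → ℤ) :
    latticeVec (k + m) = latticeVec k + latticeVec m := by
  ext i; simp

theorem latticeVec_neg (k : Fin d → ℤ) : latticeVec (-k) = -latticeVec k := by
  ext i; simp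

theorem smul_latticeVec (N : ℕ) (k : Fin d → ℤ) :
    (2 * (N : ℝ) + 1) • latticeVec k = latticeVec fun i => (2 * (N : ℤ) + 1) * k i := by
  ext i; simp

theorem period_pos (N : ℕ) : 0 < 2 * (N : ℝ) + 1 := by positivity

theorem isClosed_cube (d N : ℕ) : IsClosed (cube d N) := by
  have : cube d N = ⋂ i, {x : Space d | |x i| ≤ (N : ℝ) + 1 / 2} := by
    ext x; simp [cube]
  rw [this]
  exact isClosed_iInter fun i => isClosed_le (by fun_prop) continuous_const

theorem measurableSet_cube (d N : ℕ) : MeasurableSet (cube d N) := (isClosed_cube d N).measurableSet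

theorem cube_eq_preimage (d N : ℕ) : cube d N = WithLp.ofLp ⁻¹'
    Set.Icc (fun _ : Fin d => -((N : ℝ) + 1 / 2)) (fun _ => (N : ℝ) + 1 / 2) := by
  ext x
  simp [cube, abs_le, Pi.le_def, forall_and]

theorem volume_cube (d N : ℕ) : volume (cube d N) = ENNReal.ofReal ((2 * (N : ℝ) + 1) ^ d) := by
  rw [cube_eq_preimage, (PiLp.volume_preserving_ofLp (Fin d)).measure_preimage
    measurableSet_Icc.nullMeasurableSet, Real.volume_Icc_pi, ENNReal.ofReal_pow (period_pos N).le]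
  simp only [Finset.prod_const, Finset.card_univ, Fintype.card_fin]
  congr 2
  ring

theorem volume_real_cube (d N : ℕ) : volume.real (cube d N) = (2 * (N : ℝ) + 1) ^ d := by
  rw [Measure.real, volume_cube, ENNReal.toReal_ofReal (by positivity)]

instance isFiniteMeasure_cube (d N : ℕ) : IsFiniteMeasure (volume.restrict (cube d N)) :=
  ⟨by rw [Measure.restrict_apply_univ, volume_cube]; exact ENNReal.ofReal_lt_top⟩

theorem isCompact_cube (d N : ℕ) : IsCompact (cube d N) := by
  rw [cube_eq_preimage]
  exact (EuclideanSpace.equiv (Fin d) ℝ).toHomeomorph.isClosedEmbedding.isCompact_preimage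
    isCompact_Icc

theorem exists_norm_le_of_mem_cube (d N : ℕ) : ∃ C, 0 ≤ C ∧ ∀ x ∈ cube d N, ‖x‖ ≤ C := by
  obtain ⟨C, hC⟩ := (isCompact_cube d N).exists_bound_of_continuousOn continuousOn_id
  exact ⟨max C 0, le_max_right _ _, fun x hx => (hC x hx).trans (le_max_left _ _)⟩

theorem ae_coord_ne (i : Fin d) (c : ℝ) : ∀ᵐ x : Space d, x i ≠ c := by
  have h : Measure.QuasiMeasurePreserving (fun x : Space d => x i) volume volume :=
    (Measure.quasiMeasurePreserving_eval (fun _ : Fin d => (volume : Measure ℝ)) i).comp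
      (PiLp.volume_preserving_ofLp (Fin d)).quasiMeasurePreserving
  exact h.ae (Measure.ae_ne volume c)

/-- The translate by `-(2N+1)k` of a point, for the only `k ∈ ℤ^d` that brings it to the half-open
cube of side `2N+1`. -/
def fold (N : ℕ) (x : Space d) : Space d :=
  x - (2 * (N : ℝ) + 1) • latticeVec fun i => round (x i / (2 * (N : ℝ) + 1))

theorem fold_add (N : ℕ) (x : Space d) (k : Fin d → ℤ) :
    fold N (x + (2 * (N : ℝ) + 1) • latticeVec k) = fold N x := by
  have h := (period_pos N).ne'
  ext i
  simp only [fold, PiLp.sub_apply, PiLp.add_apply, PiLp.smul_apply, latticeVec_apply, smul_eq_mul]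
  rw [add_div, mul_div_cancel_left₀ _ h, round_add_intCast]
  push_cast
  ring

theorem fold_mem_cube (N : ℕ) (x : Space d) : fold N x ∈ cube d N := by
  intro i
  have h := period_pos N
  have h1 := abs_sub_round (x i / (2 * (N : ℝ) + 1))
  simp only [fold, PiLp.sub_apply, PiLp.smul_apply, latticeVec_apply, smul_eq_mul]
  have h2 : x i - (2 * (N : ℝ) + 1) * (round (x i / (2 * (N : ℝ) + 1)) : ℝ) =
      (2 * (N : ℝ) + 1) * (x i / (2 * (N : ℝ) + 1) - (round (x i / (2 * (N : ℝ) + 1)) : ℝ)) := by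
    rw [mul_sub, mul_div_cancel₀ _ h.ne']
  rw [h2, abs_mul, abs_of_pos h]
  nlinarith

theorem round_eq_zero_of_abs_lt {t : ℝ} (h : |t| < 1 / 2) : round t = 0 := by
  rw [abs_lt] at h
  rw [round_eq, Int.floor_eq_zero_iff]
  constructor <;> linarith

/-- Rounding can move a point of the closed cube only if it lies on a face, and the faces are null.
-/
theorem fold_eq_self_ae (d N : ℕ) : ∀ᵐ x ∂volume.restrict (cube d N), fold N x = x := by
  have h1 : ∀ᵐ x : Space d, ∀ i, x i ≠ (N : ℝ) + 1 / 2 ∧ x i ≠ -((N : ℝ) + 1 / 2) :=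
    ae_all_iff.2 fun i => (ae_coord_ne i _).and (ae_coord_ne i _)
  filter_upwards [ae_restrict_mem (measurableSet_cube d N), ae_restrict_of_ae h1] with x hx hne
  have h := period_pos N
  have hr : ∀ i, round (x i / (2 * (N : ℝ) + 1)) = 0 := by
    intro i
    refine round_eq_zero_of_abs_lt ?_
    rw [abs_div, abs_of_pos h, div_lt_iff₀ h]
    have h2 : |x i| ≠ (N : ℝ) + 1 / 2 := by
      intro h3
      rcases eq_or_eq_neg_of_abs_eq h3 with h3 | h3
      · exact (hne i).1 h3
      · exact (hne i).2 h3
    have := lt_of_le_of_ne (hx i) h2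
    linarith
  ext i
  simp [fold, hr]

theorem quasiMeasurePreserving_add_right (v : Space d) :
    Measure.QuasiMeasurePreserving (fun x : Space d => x + v) volume volume :=
  (measurePreserving_add_right volume v).quasiMeasurePreserving

/-- A property of the values of a periodic function that holds a.e. on the cell holds a.e. -/
theorem PeriodicAE.ae_of_ae_cube {N : ℕ} {f : Space d → F} (hf : PeriodicAE N f) {p : F → Prop}
    (h : ∀ᵐ x ∂volume.restrict (cube d N), p (f x)) : ∀ᵐ x, p (f x) := by
  rw [ae_restrict_iff' (measurableSet_cube d N)] at h
  have h1 : ∀ᵐ x, ∀ k : Fin d → ℤ, x + (2 * (N : ℝ) + 1) • latticeVec k ∈ cube d N →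
      p (f (x + (2 * (N : ℝ) + 1) • latticeVec k)) :=
    ae_all_iff.2 fun k => (quasiMeasurePreserving_add_right _).ae h
  filter_upwards [h1, ae_all_iff.2 hf] with x hx hp
  -- This is the translation that folds `x` back into the cell.
  have := hx (-fun i => round (x i / (2 * (N : ℝ) + 1)))
  rw [hp] at this
  apply this
  rw [latticeVec_neg, smul_neg, ← sub_eq_add_neg]
  exact fold_mem_cube N x

theorem PeriodicAE.prodMk {G : Type*} {N : ℕ} {f : Space d → F} {g : Space d → G}
    (hf : PeriodicAE N f) (hg : PeriodicAE N g) : PeriodicAE N fun x => (f x, g x) := by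
  intro k
  filter_upwards [hf k, hg k] with x h1 h2
  rw [h1, h2]

theorem PeriodicAE.comp {G : Type*} {N : ℕ} {f : Space d → F} (hf : PeriodicAE N f) (φ : F → G) :
    PeriodicAE N fun x => φ (f x) := fun k => (hf k).mono fun _ h => congrArg φ h

theorem PeriodicAE.of_zero {N : ℕ} {f : Space d → F} (hf : PeriodicAE 0 f) : PeriodicAE N f := by
  intro k
  have := hf fun i => (2 * (N : ℤ) + 1) * k i
  simpa [smul_latticeVec] using this

theorem PeriodicAE.add_latticeVec {f : Space d → F} (hf : PeriodicAE 0 f) (k : Fin d → ℤ) :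
    ∀ᵐ x, f (x + latticeVec k) = f x := by
  simpa using hf k

/-- Composition with `fold N` is the periodic extension used to turn `L²` classes on the cube into
representatives on the whole space. -/
theorem periodicAE_comp_fold (N : ℕ) (f : Space d → F) : PeriodicAE N fun x => f (fold N x) :=
  fun k => Eventually.of_forall fun x => congrArg f (fold_add N x k)

theorem comp_fold_ae_eq (N : ℕ) (f : Space d → F) :
    (fun x => f (fold N x)) =ᵐ[volume.restrict (cube d N)] f :=
  (fold_eq_self_ae d N).mono fun x h => by simp only [h]

/-- The cell of the unit tiling of `ℝ^d` with centre `k`. -/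
def cell (k : Fin d → ℤ) : Set (Space d) := {x | ∀ i, round (x i) = k i}

theorem measurableSet_cell (k : Fin d → ℤ) : MeasurableSet (cell k) := by
  have : cell k = ⋂ i, (fun x : Space d => ⌊x i + 1 / 2⌋) ⁻¹' {k i} := by
    ext x; simp [cell, round_eq]
  rw [this]
  refine MeasurableSet.iInter fun i => ?_
  have : Measurable fun x : Space d => ⌊x i + 1 / 2⌋ :=
    Int.measurable_floor.comp (by fun_prop)
  exact this (measurableSet_singleton _)

theorem pairwise_disjoint_cell : Pairwise (Function.onFun Disjoint (cell (d := d))) := by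
  intro k m hkm
  refine Set.disjoint_left.2 fun x hk hm => hkm ?_
  ext i
  rw [← hk i, ← hm i]

theorem cube_ae_eq_biUnion_cell (d N : ℕ) :
    cube d N =ᵐ[volume] ⋃ k ∈ box d N, cell k := by
  have h1 : ∀ᵐ x : Space d, ∀ i, x i ≠ (N : ℝ) + 1 / 2 ∧ x i ≠ -((N : ℝ) + 1 / 2) :=
    ae_all_iff.2 fun i => (ae_coord_ne i _).and (ae_coord_ne i _)
  refine eventuallyEq_set.2 ?_
  filter_upwards [h1] with x hne
  simp only [Set.mem_iUnion, exists_prop, mem_box, cell, Set.mem_ofPred_eq, cube]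
  constructor
  · intro hx
    refine ⟨fun i => round (x i), fun i => ?_, fun i => rfl⟩
    have h3 := hx i
    rw [abs_le] at h3 ⊢
    have h4 : x i < N + 1 / 2 := lt_of_le_of_ne h3.2 (hne i).1
    simp only [round_eq]
    constructor
    · rw [Int.le_floor]
      push_cast
      linarith
    · rw [← Int.lt_add_one_iff, Int.floor_lt]
      push_cast
      linarith
  · rintro ⟨k, hk, hxk⟩ i
    have h3 := abs_sub_round (x i)
    rw [hxk i] at h3
    have h4 : |(k i : ℝ)| ≤ N := by exact_mod_cast hk i
    have := abs_add_le (x i - k i) (k i)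
    rw [sub_add_cancel] at this
    linarith

/-- Translation invariance of Lebesgue measure, in a form that reduces measurability and integrals
on any cell to the unit cell. -/
theorem restrict_cell (k : Fin d → ℤ) : (volume : Measure (Space d)).restrict (cell k) =
    (volume.restrict (cube d 0)).map (fun x => x + latticeVec k) := by
  have h0 : volume.restrict (cube d 0) = volume.restrict (cell (0 : Fin d → ℤ)) := by
    refine Measure.restrict_congr_set ((cube_ae_eq_biUnion_cell d 0).trans ?_)
    have : box d 0 = {0} := by
      ext k; simp [mem_box, funext_iff]
    simp only [this, Finset.mem_singleton, Set.iUnion_iUnion_eq_left]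
    exact EventuallyEq.rfl
  have hpre : (fun x : Space d => x + latticeVec k) ⁻¹' cell k = cell 0 := by
    ext x
    simp [cell, round_add_intCast]
  rw [h0, ← hpre]
  exact ((measurePreserving_add_right volume (latticeVec k)).restrict_preimage
    (measurableSet_cell k)).map_eq.symm

/-- The cube `Q_N` is tiled by the translates of the unit cell by the vectors of `{-N, …, N}^d`. -/
theorem restrict_cube_eq_sum (d N : ℕ) : volume.restrict (cube d N) =
    ∑ k ∈ box d N, (volume.restrict (cube d 0)).map (fun x => x + latticeVec k) := by
  rw [Measure.restrict_congr_set (cube_ae_eq_biUnion_cell d N),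
    Measure.restrict_biUnion_finset (fun k _ m _ h => pairwise_disjoint_cell h) measurableSet_cell,
    Measure.sum_fintype, Finset.sum_coe_sort (box d N) fun k => volume.restrict (cell k)]
  exact Finset.sum_congr rfl fun k _ => restrict_cell k

theorem lintegral_cube_eq_sum (N : ℕ) (f : Space d → ℝ≥0∞) : ∫⁻ x in cube d N, f x =
    ∑ k ∈ box d N, ∫⁻ x in cube d 0, f (x + latticeVec k) := by
  rw [restrict_cube_eq_sum, lintegral_finsetSum_measure]
  exact Finset.sum_congr rfl fun k _ => (measurableEmbedding_addRight _).lintegral_map _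

theorem integral_cube_eq_sum {N : ℕ} {f : Space d → ℝ} (hf : IntegrableOn f (cube d N)) :
    ∫ x in cube d N, f x = ∑ k ∈ box d N, ∫ x in cube d 0, f (x + latticeVec k) := by
  rw [IntegrableOn, restrict_cube_eq_sum, integrable_finsetSum_measure] at hf
  rw [restrict_cube_eq_sum, integral_finsetSum_measure hf]
  exact Finset.sum_congr rfl fun k _ => (measurableEmbedding_addRight _).integral_map _

theorem lintegral_cube_of_periodic {N : ℕ} {f : Space d → ℝ≥0∞} (hf : PeriodicAE 0 f) :
    ∫⁻ x in cube d N, f x = ((2 * N + 1) ^ d : ℕ) * ∫⁻ x in cube d 0, f x := by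
  rw [lintegral_cube_eq_sum, Finset.sum_congr rfl fun k _ => lintegral_congr_ae
    (ae_restrict_of_ae (hf.add_latticeVec k)), Finset.sum_const, card_box, nsmul_eq_mul]

theorem eLpNorm_two_eq {X E : Type*} [MeasurableSpace X] {μ : Measure X} [NormedAddCommGroup E]
    (f : X → E) : eLpNorm f 2 μ = (∫⁻ x, ‖f x‖ₑ ^ 2 ∂μ) ^ (1 / 2 : ℝ) := by
  rw [eLpNorm_eq_lintegral_rpow_enorm_toReal two_ne_zero ENNReal.ofNat_ne_top]
  simp

theorem eLpNorm_cube_of_periodic {N : ℕ} {E : Type*} [NormedAddCommGroup E] {f : Space d → E}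
    (hf : PeriodicAE 0 f) : eLpNorm f 2 (volume.restrict (cube d N)) =
      ((2 * N + 1) ^ d : ℕ) ^ (1 / 2 : ℝ) * eLpNorm f 2 (volume.restrict (cube d 0)) := by
  rw [eLpNorm_two_eq, eLpNorm_two_eq, lintegral_cube_of_periodic (hf.comp fun y => ‖y‖ₑ ^ 2),
    ENNReal.mul_rpow_of_nonneg _ _ (by norm_num)]

theorem aestronglyMeasurable_of_periodic {N : ℕ} {E : Type*} [NormedAddCommGroup E]
    {f : Space d → E} (hf : PeriodicAE 0 f)
    (hm : AEStronglyMeasurable f (volume.restrict (cube d 0))) :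
    AEStronglyMeasurable f (volume.restrict (cube d N)) := by
  rw [Measure.restrict_congr_set (cube_ae_eq_biUnion_cell d N),
    Measure.restrict_biUnion_finset (fun k _ m _ h => pairwise_disjoint_cell h) measurableSet_cell,
    aestronglyMeasurable_sum_measure_iff]
  intro k
  rw [restrict_cell, (measurableEmbedding_addRight _).aestronglyMeasurable_map_iff]
  exact hm.congr (ae_restrict_of_ae ((hf.add_latticeVec k).mono fun x h => h.symm))

theorem memLp_cube_of_periodic {N : ℕ} {E : Type*} [NormedAddCommGroup E] {f : Space d → E}
    (hf : PeriodicAE 0 f) (h : MemLp f 2 (volume.restrict (cube d 0))) :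
    MemLp f 2 (volume.restrict (cube d N)) := by
  refine ⟨aestronglyMeasurable_of_periodic hf h.1, ?_⟩
  rw [eLpNorm_cube_of_periodic hf]
  exact ENNReal.mul_lt_top (ENNReal.rpow_lt_top_of_nonneg (by norm_num) (ENNReal.natCast_ne_top _))
    h.2

/-- The lattice `(2N+1) ℤ^d`. -/
def periodLattice (d N : ℕ) : AddSubgroup (Space d) :=
  AddMonoidHom.range (AddMonoidHom.mk' (fun k : Fin d → ℤ => (2 * (N : ℝ) + 1) • latticeVec k)
    fun k m => by rw [latticeVec_add, smul_add])

instance countable_periodLattice (d N : ℕ) : Countable (periodLattice d N) :=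
  (Set.countable_range _).to_subtype

/-- The half-open cube of side `2N+1` and centre `h`. -/
def halfOpenCube (d N : ℕ) (h : Space d) : Set (Space d) :=
  {x | ∀ i, round ((x i - h i) / (2 * (N : ℝ) + 1)) = 0}

/-- Rounding the coordinates relative to `h` determines the only period that brings a point into the
cube. The centre is free so that a cube can be compared with its translates. -/
theorem isAddFundamentalDomain_halfOpenCube (d N : ℕ) (h : Space d) :
    IsAddFundamentalDomain (periodLattice d N) (halfOpenCube d N h) volume := by
  have hN := (period_pos N).ne'
  refine IsAddFundamentalDomain.mk' ?_ fun x => ?_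
  · have : halfOpenCube d N h =
        ⋂ i, (fun x : Space d => ⌊(x i - h i) / (2 * (N : ℝ) + 1) + 1 / 2⌋) ⁻¹' {0} := by
      ext x; simp [halfOpenCube, round_eq]
    rw [this]
    refine (MeasurableSet.iInter fun i => ?_).nullMeasurableSet
    have : Measurable fun x : Space d => ⌊(x i - h i) / (2 * (N : ℝ) + 1) + 1 / 2⌋ :=
      Int.measurable_floor.comp (by fun_prop)
    exact this (measurableSet_singleton _)
  · have key : ∀ (k : Fin d → ℤ), (2 * (N : ℝ) + 1) • latticeVec k + x ∈ halfOpenCube d N h ↔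
        ∀ i, k i = -round ((x i - h i) / (2 * (N : ℝ) + 1)) := by
      intro k
      refine forall_congr' fun i => ?_
      have : ((2 * (N : ℝ) + 1) • latticeVec k + x) i - h i =
          (2 * (N : ℝ) + 1) * k i + (x i - h i) := by
        simp; ring
      rw [this, add_div, mul_div_cancel_left₀ _ hN, add_comm, round_add_intCast]
      omega
    refine ⟨⟨(2 * (N : ℝ) + 1) • latticeVec fun i => -round ((x i - h i) / (2 * (N : ℝ) + 1)),
      _, rfl⟩, (key _).2 fun i => rfl, ?_⟩
    rintro ⟨_, k, rfl⟩ hk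
    have := funext ((key k).1 hk)
    subst this
    rfl

theorem halfOpenCube_zero_ae_eq (d N : ℕ) : halfOpenCube d N 0 =ᵐ[volume] cube d N := by
  have h1 := fold_eq_self_ae d N
  rw [ae_restrict_iff' (measurableSet_cube d N)] at h1
  refine eventuallyEq_set.2 ?_
  have hN := (period_pos N).ne'
  filter_upwards [h1] with x hx
  constructor
  · intro h
    have : fold N x = x := by
      ext i
      have := h i
      simp only [PiLp.zero_apply, sub_zero] at this
      simp [fold, this]
    rw [← this]
    exact fold_mem_cube N x
  · intro h i
    have h2 : fold N x i = x i := by rw [hx h]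
    simp only [fold, PiLp.sub_apply, PiLp.smul_apply, latticeVec_apply, smul_eq_mul,
      sub_eq_self, mul_eq_zero, hN, false_or, Int.cast_eq_zero] at h2
    simpa using h2

/-- The integral of a periodic function over its cell does not change under translations. -/
theorem lintegral_cube_comp_add {N : ℕ} {f : Space d → ℝ≥0∞}
    (hf : ∀ (k : Fin d → ℤ) x, f (x + (2 * (N : ℝ) + 1) • latticeVec k) = f x) (h : Space d) :
    ∫⁻ x in cube d N, f (x + h) = ∫⁻ x in cube d N, f x := by
  rw [← setLIntegral_congr (halfOpenCube_zero_ae_eq d N),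
    ← setLIntegral_congr (halfOpenCube_zero_ae_eq d N)]
  -- The translation only changes the fundamental domain, and a periodic function has the same
  -- integral over any two of them.
  have hpre : halfOpenCube d N 0 = (fun x => x + h) ⁻¹' halfOpenCube d N h := by
    ext x; simp [halfOpenCube]
  have h1 : ∫⁻ x in halfOpenCube d N 0, f (x + h) = ∫⁻ x in halfOpenCube d N h, f x := by
    rw [hpre]
    exact (measurePreserving_add_right volume h).setLIntegral_comp_preimage_emb
      (measurableEmbedding_addRight h) f _
  rw [h1]
  refine (isAddFundamentalDomain_halfOpenCube d N h).setLIntegral_eq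
    (isAddFundamentalDomain_halfOpenCube d N 0) f ?_
  rintro ⟨_, k, rfl⟩ x
  rw [← hf k x, add_comm x]
  rfl

end Cubes

/-! ### Smooth periodic functions and the Poincaré inequality -/

section SmoothPeriodic

variable {d N : ℕ} {φ ψ : Space d → ℝ}

theorem SmoothPeriodic.differentiable (h : SmoothPeriodic N φ) : Differentiable ℝ φ :=
  h.1.differentiable (by simp)

theorem SmoothPeriodic.continuous (h : SmoothPeriodic N φ) : Continuous φ := h.1.continuous

theorem SmoothPeriodic.continuous_gradient (h : SmoothPeriodic N φ) : Continuous (gradient φ) :=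
  (InnerProductSpace.toDual ℝ (Space d)).symm.continuous.comp (h.1.continuous_fderiv (by simp))

theorem gradient_add' (hφ : Differentiable ℝ φ) (hψ : Differentiable ℝ ψ) (x : Space d) :
    gradient (fun x => φ x + ψ x) x = gradient φ x + gradient ψ x := by
  simp [gradient, fderiv_fun_add (hφ x) (hψ x)]

theorem gradient_sub' (hφ : Differentiable ℝ φ) (hψ : Differentiable ℝ ψ) (x : Space d) :
    gradient (fun x => φ x - ψ x) x = gradient φ x - gradient ψ x := by
  simp [gradient, fderiv_fun_sub (hφ x) (hψ x)]

theorem gradient_const_mul' (hφ : Differentiable ℝ φ) (c : ℝ) (x : Space d) :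
    gradient (fun x => c * φ x) x = c • gradient φ x := by
  simp [gradient, fderiv_const_mul (hφ x)]

theorem gradient_sub_const' (c : ℝ) (x : Space d) :
    gradient (fun x => φ x - c) x = gradient φ x := by
  simp only [gradient, fderiv_sub_const]

theorem gradient_comp_add (v x : Space d) :
    gradient (fun x => φ (x + v)) x = gradient φ (x + v) := by
  simp [gradient, fderiv_comp_add_right]

theorem gradient_sum' {ι : Type*} (s : Finset ι) {f : ι → Space d → ℝ}
    (hf : ∀ i, Differentiable ℝ (f i)) (x : Space d) :
    gradient (fun x => ∑ i ∈ s, f i x) x = ∑ i ∈ s, gradient (f i) x := by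
  simp [gradient, fderiv_fun_sum fun i _ => (hf i) x]

theorem SmoothPeriodic.gradient_periodic (h : SmoothPeriodic N φ) (k : Fin d → ℤ) (x : Space d) :
    gradient φ (x + (2 * (N : ℝ) + 1) • latticeVec k) = gradient φ x := by
  rw [← gradient_comp_add]
  congr 1
  exact funext fun y => h.2 k y

theorem SmoothPeriodic.add (hφ : SmoothPeriodic N φ) (hψ : SmoothPeriodic N ψ) :
    SmoothPeriodic N fun x => φ x + ψ x :=
  ⟨hφ.1.add hψ.1, fun k x => by simp only [hφ.2, hψ.2]⟩

theorem SmoothPeriodic.sub (hφ : SmoothPeriodic N φ) (hψ : SmoothPeriodic N ψ) :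
    SmoothPeriodic N fun x => φ x - ψ x :=
  ⟨hφ.1.sub hψ.1, fun k x => by simp only [hφ.2, hψ.2]⟩

theorem SmoothPeriodic.const_mul (hφ : SmoothPeriodic N φ) (c : ℝ) :
    SmoothPeriodic N fun x => c * φ x :=
  ⟨contDiff_const.mul hφ.1, fun k x => by simp only [hφ.2]⟩

theorem smoothPeriodic_const (c : ℝ) : SmoothPeriodic N fun _ : Space d => c :=
  ⟨contDiff_const, fun _ _ => rfl⟩

theorem memLp_cube_of_continuous {E : Type*} [NormedAddCommGroup E]
    {f : Space d → E} (hf : Continuous f) (p : ℝ≥0∞) : MemLp f p (volume.restrict (cube d N)) := by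
  obtain ⟨C, hC⟩ := (isCompact_cube d N).exists_bound_of_continuousOn hf.continuousOn
  refine MemLp.of_bound hf.aestronglyMeasurable C ?_
  exact (ae_restrict_mem (measurableSet_cube d N)).mono fun x hx => hC x hx

/-- The fundamental theorem of calculus on the segment from `x` to `x + h`, followed by the
comparison of `L¹` and `L²` norms on the unit interval, a probability space. -/
theorem enorm_sub_sq_le (hφ : SmoothPeriodic N φ) (x h : Space d) :
    ‖φ (x + h) - φ x‖ₑ ^ 2 ≤
      ‖h‖ₑ ^ 2 * ∫⁻ t in Set.Ioc (0 : ℝ) 1, ‖gradient φ (x + t • h)‖ₑ ^ 2 := by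
  have hcont : Continuous fun t : ℝ => gradient φ (x + t • h) :=
    hφ.continuous_gradient.comp (by fun_prop)
  have hderiv : ∀ t : ℝ, HasDerivAt (fun t : ℝ => φ (x + t • h))
      (inner ℝ (gradient φ (x + t • h)) h) t := by
    intro t
    have h1 : HasDerivAt (fun t : ℝ => x + t • h) h t := by
      simpa using ((hasDerivAt_id t).smul_const h).const_add x
    have h2 := (hφ.differentiable (x + t • h)).hasFDerivAt.comp_hasDerivAt t h1
    rwa [inner_gradient_left]
  have hftc : φ (x + h) - φ x = ∫ t in Set.Ioc (0 : ℝ) 1, inner ℝ (gradient φ (x + t • h)) h := by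
    rw [← intervalIntegral.integral_of_le zero_le_one,
      intervalIntegral.integral_eq_sub_of_hasDerivAt (fun t _ => hderiv t)
        ((hcont.inner continuous_const).intervalIntegrable _ _)]
    simp
  have : IsProbabilityMeasure ((volume : Measure ℝ).restrict (Set.Ioc (0 : ℝ) 1)) :=
    ⟨by simp⟩
  have h1 : ‖φ (x + h) - φ x‖ₑ ≤
      ∫⁻ t in Set.Ioc (0 : ℝ) 1, ‖h‖ₑ * ‖gradient φ (x + t • h)‖ₑ := by
    rw [hftc]
    refine (enorm_integral_le_lintegral_enorm _).trans (lintegral_mono fun t => ?_)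
    rw [mul_comm, ← ofReal_norm, ← ofReal_norm, ← ofReal_norm,
      ← ENNReal.ofReal_mul (norm_nonneg _)]
    exact ENNReal.ofReal_le_ofReal (norm_inner_le_norm _ _)
  have h2 : ∫⁻ t in Set.Ioc (0 : ℝ) 1, ‖gradient φ (x + t • h)‖ₑ ≤
      (∫⁻ t in Set.Ioc (0 : ℝ) 1, ‖gradient φ (x + t • h)‖ₑ ^ 2) ^ (1 / 2 : ℝ) := by
    rw [← eLpNorm_two_eq, ← eLpNorm_one_eq_lintegral_enorm]
    exact eLpNorm_le_eLpNorm_of_exponent_le one_le_two hcont.aestronglyMeasurable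
  rw [lintegral_const_mul' _ _ enorm_ne_top] at h1
  calc ‖φ (x + h) - φ x‖ₑ ^ 2
      ≤ (‖h‖ₑ * (∫⁻ t in Set.Ioc (0 : ℝ) 1, ‖gradient φ (x + t • h)‖ₑ ^ 2) ^ (1 / 2 : ℝ)) ^ 2 := by
        gcongr
        exact h1.trans (by gcongr)
    _ = _ := by
        rw [mul_pow, ← ENNReal.rpow_natCast (_ ^ (1 / 2 : ℝ)), ← ENNReal.rpow_mul]
        norm_num

/-- After exchanging the integrals, each slice in `t` integrates a translate of `|∇φ|²` over a full
period, which does not depend on `t`. -/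
theorem lintegral_translate_sub_sq_le (hφ : SmoothPeriodic N φ) (h : Space d) :
    ∫⁻ x in cube d N, ‖φ (x + h) - φ x‖ₑ ^ 2 ≤
      ‖h‖ₑ ^ 2 * ∫⁻ x in cube d N, ‖gradient φ x‖ₑ ^ 2 := by
  have hcont : Continuous fun z : Space d × ℝ => gradient φ (z.1 + z.2 • h) :=
    hφ.continuous_gradient.comp (by fun_prop)
  calc ∫⁻ x in cube d N, ‖φ (x + h) - φ x‖ₑ ^ 2
      ≤ ∫⁻ x in cube d N,
          ‖h‖ₑ ^ 2 * ∫⁻ t in Set.Ioc (0 : ℝ) 1, ‖gradient φ (x + t • h)‖ₑ ^ 2 :=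
        lintegral_mono fun x => enorm_sub_sq_le hφ x h
    _ = ‖h‖ₑ ^ 2 * ∫⁻ x in cube d N,
          ∫⁻ t in Set.Ioc (0 : ℝ) 1, ‖gradient φ (x + t • h)‖ₑ ^ 2 :=
        lintegral_const_mul' _ _ (by simp)
    _ = ‖h‖ₑ ^ 2 * ∫⁻ t in Set.Ioc (0 : ℝ) 1,
          ∫⁻ x in cube d N, ‖gradient φ (x + t • h)‖ₑ ^ 2 := by
        rw [lintegral_lintegral_swap]
        exact (hcont.enorm.measurable.pow_const 2).aemeasurable
    _ = ‖h‖ₑ ^ 2 * ∫⁻ _ in Set.Ioc (0 : ℝ) 1, ∫⁻ x in cube d N, ‖gradient φ x‖ₑ ^ 2 := by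
        congr 1
        refine lintegral_congr fun t => ?_
        exact lintegral_cube_comp_add (f := fun x => ‖gradient φ x‖ₑ ^ 2)
          (fun k x => by rw [hφ.gradient_periodic]) (t • h)
    _ = ‖h‖ₑ ^ 2 * ∫⁻ x in cube d N, ‖gradient φ x‖ₑ ^ 2 := by simp

theorem lintegral_enorm_sq_eq {X : Type*} [MeasurableSpace X] {μ : Measure X} {f : X → ℝ}
    (hf : MemLp f 2 μ) : ∫⁻ x, ‖f x‖ₑ ^ 2 ∂μ = ENNReal.ofReal (∫ x, f x ^ 2 ∂μ) := by
  rw [ofReal_integral_eq_lintegral_ofReal hf.integrable_sq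
    (Eventually.of_forall fun x => sq_nonneg _)]
  refine lintegral_congr fun x => ?_
  rw [← ofReal_norm, ← ENNReal.ofReal_pow (norm_nonneg _), Real.norm_eq_abs, sq_abs]

/-- The Poincaré inequality for periodic functions of mean zero. -/
theorem exists_poincare (d N : ℕ) : ∃ C : ℝ≥0∞, C ≠ ∞ ∧ ∀ φ : Space d → ℝ, SmoothPeriodic N φ →
    ∫ x in cube d N, φ x = 0 → eLpNorm φ 2 (volume.restrict (cube d N)) ≤
      C * eLpNorm (gradient φ) 2 (volume.restrict (cube d N)) := by
  obtain ⟨C, hC0, hC⟩ := exists_norm_le_of_mem_cube d N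
  refine ⟨ENNReal.ofReal C, ENNReal.ofReal_ne_top, fun φ hφ h0 => ?_⟩
  have hL : ∀ c : ℝ, MemLp (fun y => φ y - c) 2 (volume.restrict (cube d N)) := fun c =>
    memLp_cube_of_continuous (hφ.continuous.sub continuous_const) 2
  have hφ2 : MemLp φ 2 (volume.restrict (cube d N)) := memLp_cube_of_continuous hφ.continuous 2
  have hφ1 : IntegrableOn φ (cube d N) := hφ2.integrable one_le_two
  -- The mean of `φ` is zero, so the cross term vanishes and subtracting a constant can only
  -- increase the norm.
  have hlow : ∀ x, ∫⁻ y in cube d N, ‖φ y‖ₑ ^ 2 ≤ ∫⁻ y in cube d N, ‖φ y - φ x‖ₑ ^ 2 := by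
    intro x
    rw [lintegral_enorm_sq_eq hφ2, lintegral_enorm_sq_eq (hL (φ x))]
    refine ENNReal.ofReal_le_ofReal ?_
    have h1 : ∫ y in cube d N, (φ y - φ x) ^ 2 =
        ∫ y in cube d N, (φ y ^ 2 - 2 * φ x * φ y + φ x ^ 2) := by
      congr 1; ext y; ring
    have hi : IntegrableOn (fun y => φ y ^ 2 - 2 * φ x * φ y) (cube d N) :=
      hφ2.integrable_sq.sub (hφ1.const_mul _)
    rw [h1, integral_add hi (integrable_const _),
      integral_sub hφ2.integrable_sq (hφ1.const_mul _), integral_const_mul, h0, integral_const]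
    have : 0 ≤ (volume.restrict (cube d N)).real Set.univ • φ x ^ 2 :=
      smul_nonneg measureReal_nonneg (sq_nonneg _)
    linarith
  -- By periodicity `y` may be replaced by `x + h` with `h` in the cube, so all increments satisfy
  -- `|h| ≤ C`. The volume factor cancels against the one from integrating `hlow` in `x`.
  have hup : ∫⁻ x in cube d N, ∫⁻ y in cube d N, ‖φ y - φ x‖ₑ ^ 2 ≤
      volume (cube d N) * (ENNReal.ofReal C ^ 2 * ∫⁻ x in cube d N, ‖gradient φ x‖ₑ ^ 2) := by
    calc ∫⁻ x in cube d N, ∫⁻ y in cube d N, ‖φ y - φ x‖ₑ ^ 2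
        = ∫⁻ x in cube d N, ∫⁻ h in cube d N, ‖φ (x + h) - φ x‖ₑ ^ 2 := by
          refine lintegral_congr fun x => ?_
          rw [← lintegral_cube_comp_add (f := fun y => ‖φ y - φ x‖ₑ ^ 2)
            (fun k y => by rw [hφ.2]) x]
          simp only [add_comm x]
      _ = ∫⁻ h in cube d N, ∫⁻ x in cube d N, ‖φ (x + h) - φ x‖ₑ ^ 2 := by
          rw [lintegral_lintegral_swap]
          have : Continuous fun z : Space d × Space d => φ (z.1 + z.2) - φ z.1 :=
            (hφ.continuous.comp (by fun_prop)).sub (hφ.continuous.comp (by fun_prop))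
          exact (this.enorm.measurable.pow_const 2).aemeasurable
      _ ≤ ∫⁻ _ in cube d N, ENNReal.ofReal C ^ 2 * ∫⁻ x in cube d N, ‖gradient φ x‖ₑ ^ 2 := by
          refine lintegral_mono_ae ?_
          filter_upwards [ae_restrict_mem (measurableSet_cube d N)] with h hh
          refine (lintegral_translate_sub_sq_le hφ h).trans ?_
          gcongr
          rw [← ofReal_norm]
          exact ENNReal.ofReal_le_ofReal (hC h hh)
      _ = _ := by rw [setLIntegral_const, mul_comm]
  have hvol0 : volume (cube d N) ≠ 0 := by
    rw [volume_cube]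
    have : 0 < (2 * (N : ℝ) + 1) ^ d := by positivity
    simpa using this
  have hvolt : volume (cube d N) ≠ ∞ := by
    rw [volume_cube]
    exact ENNReal.ofReal_ne_top
  have hfin : ∫⁻ y in cube d N, ‖φ y‖ₑ ^ 2 ≤
      ENNReal.ofReal C ^ 2 * ∫⁻ x in cube d N, ‖gradient φ x‖ₑ ^ 2 := by
    have h1 := (lintegral_mono (μ := volume.restrict (cube d N)) fun x => hlow x).trans hup
    rw [setLIntegral_const, mul_comm] at h1
    exact (ENNReal.mul_le_mul_iff_right hvol0 hvolt).1 h1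
  rw [eLpNorm_two_eq, eLpNorm_two_eq]
  calc (∫⁻ y in cube d N, ‖φ y‖ₑ ^ 2) ^ (1 / 2 : ℝ)
      ≤ (ENNReal.ofReal C ^ 2 * ∫⁻ x in cube d N, ‖gradient φ x‖ₑ ^ 2) ^ (1 / 2 : ℝ) := by
        gcongr
    _ = _ := by
        rw [ENNReal.mul_rpow_of_nonneg _ _ (by norm_num), ← ENNReal.rpow_natCast,
          ← ENNReal.rpow_mul]
        norm_num

end SmoothPeriodic

/-! ### The space `H¹_per(Q_N)` -/

section H1Per

variable {d N : ℕ}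

theorem tendsto_eLpNorm_sub {X E ι : Type*} [MeasurableSpace X] {μ : Measure X}
    [NormedAddCommGroup E] {l : Filter ι} {f g : ι → X → E} {F G : X → E}
    (hf : ∀ i, MemLp (f i) 2 μ) (hg : ∀ i, MemLp (g i) 2 μ) (hF : MemLp F 2 μ) (hG : MemLp G 2 μ)
    (h1 : Tendsto (fun i => eLpNorm (fun x => f i x - F x) 2 μ) l (𝓝 0))
    (h2 : Tendsto (fun i => eLpNorm (fun x => g i x - G x) 2 μ) l (𝓝 0)) :
    Tendsto (fun i => eLpNorm (fun x => f i x - g i x - (F x - G x)) 2 μ) l (𝓝 0) := by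
  have h3 := h1.add h2
  rw [add_zero] at h3
  refine tendsto_of_tendsto_of_tendsto_of_le_of_le tendsto_const_nhds h3 (fun _ => zero_le)
    fun i => ?_
  have : (fun x => f i x - g i x - (F x - G x)) = (f i - F) - (g i - G) := by
    ext x
    simp only [Pi.sub_apply]
    abel
  rw [this]
  exact eLpNorm_sub_le ((hf i).sub hF).1 ((hg i).sub hG).1 one_le_two

theorem SmoothPeriodic.memLp {φ : Space d → ℝ} (h : SmoothPeriodic N φ) :
    MemLp φ 2 (volume.restrict (cube d N)) := memLp_cube_of_continuous h.continuous 2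

theorem SmoothPeriodic.memLp_gradient {φ : Space d → ℝ} (h : SmoothPeriodic N φ) :
    MemLp (gradient φ) 2 (volume.restrict (cube d N)) :=
  memLp_cube_of_continuous h.continuous_gradient 2

/-- The difference of two elements of `H¹_per(Q_N)`. -/
def H1Per.sub (w w' : H1Per d N) : H1Per d N where
  toFun x := w.toFun x - w'.toFun x
  grad x := w.grad x - w'.grad x
  memLp_toFun := w.memLp_toFun.sub w'.memLp_toFun
  memLp_grad := w.memLp_grad.sub w'.memLp_grad
  periodic_toFun := (w.periodic_toFun.prodMk w'.periodic_toFun).comp fun z => z.1 - z.2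
  periodic_grad := (w.periodic_grad.prodMk w'.periodic_grad).comp fun z => z.1 - z.2
  approx := by
    obtain ⟨φ, hφ, h1, h2⟩ := w.approx
    obtain ⟨φ', hφ', h1', h2'⟩ := w'.approx
    refine ⟨fun n x => φ n x - φ' n x, fun n => (hφ n).sub (hφ' n), ?_, ?_⟩
    · exact tendsto_eLpNorm_sub (fun n => (hφ n).memLp) (fun n => (hφ' n).memLp)
        w.memLp_toFun w'.memLp_toFun h1 h1'
    · simp only [gradient_sub' (hφ _).differentiable (hφ' _).differentiable]
      exact tendsto_eLpNorm_sub (fun n => (hφ n).memLp_gradient) (fun n => (hφ' n).memLp_gradient)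
        w.memLp_grad w'.memLp_grad h2 h2'

/-- A smooth periodic function as an element of `H¹_per(Q_N)`. -/
def H1Per.ofSmooth {φ : Space d → ℝ} (h : SmoothPeriodic N φ) : H1Per d N where
  toFun := φ
  grad := gradient φ
  memLp_toFun := h.memLp
  memLp_grad := h.memLp_gradient
  periodic_toFun k := Eventually.of_forall (h.2 k)
  periodic_grad k := Eventually.of_forall (h.gradient_periodic k)
  approx := ⟨fun _ => φ, fun _ => h, by simp, by simp⟩

theorem SmoothPeriodic.of_zero {φ : Space d → ℝ} (h : SmoothPeriodic 0 φ) :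
    SmoothPeriodic N φ := by
  refine ⟨h.1, fun k x => ?_⟩
  have := h.2 (fun i => (2 * (N : ℤ) + 1) * k i) x
  simpa [smul_latticeVec] using this

theorem tendsto_eLpNorm_cube_of_periodic {E : Type*} [NormedAddCommGroup E]
    {f : ℕ → Space d → E} (hf : ∀ n, PeriodicAE 0 (f n))
    (h : Tendsto (fun n => eLpNorm (f n) 2 (volume.restrict (cube d 0))) atTop (𝓝 0)) :
    Tendsto (fun n => eLpNorm (f n) 2 (volume.restrict (cube d N))) atTop (𝓝 0) := by
  simp only [fun n => eLpNorm_cube_of_periodic (N := N) (hf n)]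
  have := ENNReal.Tendsto.const_mul (a := (((2 * N + 1) ^ d : ℕ) : ℝ≥0∞) ^ (1 / 2 : ℝ)) h
    (Or.inr (ENNReal.rpow_ne_top_of_nonneg (by norm_num) (ENNReal.natCast_ne_top _)))
  simpa using this

/-- A `Q`-periodic function is `Q_N`-periodic. -/
def H1Per.ofZero (N : ℕ) (w : H1Per d 0) : H1Per d N where
  toFun := w.toFun
  grad := w.grad
  memLp_toFun := memLp_cube_of_periodic w.periodic_toFun w.memLp_toFun
  memLp_grad := memLp_cube_of_periodic w.periodic_grad w.memLp_grad
  periodic_toFun := w.periodic_toFun.of_zero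
  periodic_grad := w.periodic_grad.of_zero
  approx := by
    obtain ⟨φ, hφ, h1, h2⟩ := w.approx
    refine ⟨φ, fun n => (hφ n).of_zero, ?_, ?_⟩
    · refine tendsto_eLpNorm_cube_of_periodic (fun n => ?_) h1
      exact (PeriodicAE.prodMk (fun k => Eventually.of_forall ((hφ n).2 k))
        w.periodic_toFun).comp fun z => z.1 - z.2
    · refine tendsto_eLpNorm_cube_of_periodic (fun n => ?_) h2
      exact (PeriodicAE.prodMk (fun k => Eventually.of_forall ((hφ n).gradient_periodic k))
        w.periodic_grad).comp fun z => z.1 - z.2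

/-- The gradients of the smooth `Q_N`-periodic functions, as a subspace of `L²(Q_N)^d`. -/
def smoothGradients (d N : ℕ) : Submodule ℝ (Lp (Space d) 2 (volume.restrict (cube d N))) where
  carrier := {F | ∃ (φ : Space d → ℝ) (h : SmoothPeriodic N φ), F = h.memLp_gradient.toLp}
  zero_mem' := by
    refine ⟨fun _ => 0, smoothPeriodic_const 0, ?_⟩
    rw [eq_comm, Lp.eq_zero_iff_ae_eq_zero]
    refine (MemLp.coeFn_toLp _).trans (Eventually.of_forall fun x => ?_)
    simp
  add_mem' := by
    rintro _ _ ⟨φ, hφ, rfl⟩ ⟨ψ, hψ, rfl⟩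
    refine ⟨_, hφ.add hψ, ?_⟩
    rw [← MemLp.toLp_add, MemLp.toLp_eq_toLp_iff]
    exact Eventually.of_forall fun x =>
      (gradient_add' hφ.differentiable hψ.differentiable x).symm
  smul_mem' := by
    rintro c _ ⟨φ, hφ, rfl⟩
    refine ⟨_, hφ.const_mul c, ?_⟩
    rw [← MemLp.toLp_const_smul, MemLp.toLp_eq_toLp_iff]
    exact Eventually.of_forall fun x => (gradient_const_mul' hφ.differentiable c x).symm

/-- The gradients of the elements of `H¹_per(Q_N)`. -/
abbrev potentialFields (d N : ℕ) : Submodule ℝ (Lp (Space d) 2 (volume.restrict (cube d N))) :=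
  (smoothGradients d N).topologicalClosure

theorem H1Per.toLp_grad_mem (w : H1Per d N) : w.memLp_grad.toLp ∈ potentialFields d N := by
  obtain ⟨φ, hφ, -, h2⟩ := w.approx
  refine mem_closure_of_tendsto (b := atTop) (f := fun n => (hφ n).memLp_gradient.toLp) ?_
    (Eventually.of_forall fun n => ⟨φ n, hφ n, rfl⟩)
  rw [Lp.tendsto_Lp_iff_tendsto_eLpNorm'']
  exact h2

theorem integral_sub_average {φ : Space d → ℝ} (hφ : IntegrableOn φ (cube d N)) :
    ∫ x in cube d N, (φ x - (volume.real (cube d N))⁻¹ * ∫ y in cube d N, φ y) = 0 := by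
  have : volume.real (cube d N) ≠ 0 := by
    rw [volume_real_cube]
    positivity
  rw [integral_sub hφ (integrable_const _), setIntegral_const, smul_eq_mul,
    mul_inv_cancel_left₀ this, sub_self]

/-- Approximating potentials are normalized to mean zero; the Poincaré inequality then makes them
Cauchy in `L²` as soon as their gradients are. With `H1Per.toLp_grad_mem`, this identifies the
closure of the smooth gradients with the gradients of `H¹_per(Q_N)`. -/
theorem exists_h1Per_of_mem {G : Lp (Space d) 2 (volume.restrict (cube d N))}
    (hG : G ∈ potentialFields d N) :
    ∃ w : H1Per d N, w.grad =ᵐ[volume.restrict (cube d N)] G := by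
  obtain ⟨F, hF, hlim⟩ := mem_closure_iff_seq_limit.1 hG
  choose φ hφ hFφ using hF
  set c : ℕ → ℝ := fun n => (volume.real (cube d N))⁻¹ * ∫ y in cube d N, φ n y with hc
  set ψ : ℕ → Space d → ℝ := fun n x => φ n x - c n with hψdef
  have hψ : ∀ n, SmoothPeriodic N (ψ n) := fun n => (hφ n).sub (smoothPeriodic_const _)
  have hgrad : ∀ n, gradient (ψ n) = gradient (φ n) := fun n =>
    funext fun x => gradient_sub_const' _ x
  have hint : ∀ n, IntegrableOn (ψ n) (cube d N) := fun n => (hψ n).memLp.integrable one_le_two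
  have hzero : ∀ n, ∫ x in cube d N, ψ n x = 0 := fun n =>
    integral_sub_average ((hφ n).memLp.integrable one_le_two)
  obtain ⟨C, hC, hpoin⟩ := exists_poincare d N
  have hbound : ∀ n m,
      edist (hψ n).memLp.toLp (hψ m).memLp.toLp ≤ C.toNNReal * edist (F n) (F m) := by
    intro n m
    rw [hFφ n, hFφ m, Lp.edist_toLp_toLp, Lp.edist_toLp_toLp, ENNReal.coe_toNNReal hC]
    have h1 := hpoin _ ((hψ n).sub (hψ m))
      (by rw [integral_sub (hint n) (hint m), hzero, hzero, sub_zero])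
    refine h1.trans (le_of_eq ?_)
    congr 2
    ext1 x
    rw [gradient_sub' (hψ n).differentiable (hψ m).differentiable, hgrad, hgrad, Pi.sub_apply]
  have hcauchy : CauchySeq fun n => (hψ n).memLp.toLp := by
    have hFc := hlim.cauchySeq
    rw [EMetric.cauchySeq_iff] at hFc ⊢
    intro ε hε
    -- Adding 1 avoids a division by zero when the Poincaré constant vanishes.
    have hpos : 0 < ε / (C.toNNReal + 1 : ℝ≥0∞) :=
      ENNReal.div_pos hε.ne' (by simp)
    obtain ⟨n₀, hn₀⟩ := hFc _ hpos
    refine ⟨n₀, fun m hm n hn => ?_⟩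
    have h1 := hn₀ m hm n hn
    rw [ENNReal.lt_div_iff_mul_lt (Or.inl (by simp)) (Or.inl (by simp))] at h1
    refine lt_of_le_of_lt ((hbound m n).trans ?_) h1
    rw [mul_comm]
    gcongr
    exact le_self_add
  obtain ⟨U, hU⟩ := cauchySeq_tendsto_of_complete hcauchy
  have hUf := comp_fold_ae_eq N U
  have hGf := comp_fold_ae_eq N G
  refine ⟨{ toFun := fun x => U (fold N x)
            grad := fun x => G (fold N x)
            memLp_toFun := (Lp.memLp U).ae_eq hUf.symm
            memLp_grad := (Lp.memLp G).ae_eq hGf.symm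
            periodic_toFun := periodicAE_comp_fold N U
            periodic_grad := periodicAE_comp_fold N G
            approx := ⟨ψ, hψ, ?_, ?_⟩ }, hGf⟩
  · rw [Lp.tendsto_Lp_iff_tendsto_eLpNorm'] at hU
    refine hU.congr fun n => eLpNorm_congr_ae ?_
    filter_upwards [hUf, (hψ n).memLp.coeFn_toLp] with x h1 h2
    simp only [Pi.sub_apply, h1, h2]
  · rw [Lp.tendsto_Lp_iff_tendsto_eLpNorm'] at hlim
    refine hlim.congr fun n => eLpNorm_congr_ae ?_
    have h3 : F n =ᵐ[volume.restrict (cube d N)] gradient (φ n) := by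
      rw [hFφ n]
      exact MemLp.coeFn_toLp _
    filter_upwards [hGf, h3] with x h1 h2
    simp only [Pi.sub_apply, h1, h2, hgrad]

/-- An element of `H¹_per(Q_N)` whose gradient vanishes is constant. -/
theorem H1Per.exists_const_of_grad_eq_zero (w : H1Per d N)
    (h : w.grad =ᵐ[volume.restrict (cube d N)] 0) : ∃ c : ℝ, ∀ᵐ x, w.toFun x = c := by
  obtain ⟨φ, hφ, h1, h2⟩ := w.approx
  set μ := volume.restrict (cube d N) with hμ
  set c : ℕ → ℝ := fun n => (volume.real (cube d N))⁻¹ * ∫ y in cube d N, φ n y with hc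
  set c' : ℝ := (volume.real (cube d N))⁻¹ * ∫ y in cube d N, w.toFun y with hc'
  have hφi : ∀ n, Integrable (φ n) μ := fun n => (hφ n).memLp.integrable one_le_two
  -- Convergence in `L²` implies convergence in `L¹` on a cube of finite measure, hence convergence
  -- of the means.
  have hcc : Tendsto c atTop (𝓝 c') := by
    refine Tendsto.const_mul _ (tendsto_integral_of_L1' _ w.memLp_toFun.1
      (Eventually.of_forall hφi) ?_)
    have hup : Tendsto (fun n => eLpNorm (fun x => φ n x - w.toFun x) 2 μ *
        μ Set.univ ^ (1 / (1 : ℝ≥0∞).toReal - 1 / (2 : ℝ≥0∞).toReal)) atTop (𝓝 0) := by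
      have := ENNReal.Tendsto.mul_const (b := μ Set.univ ^
        (1 / (1 : ℝ≥0∞).toReal - 1 / (2 : ℝ≥0∞).toReal)) h1
        (Or.inr (ENNReal.rpow_ne_top_of_nonneg (by norm_num) (measure_ne_top _ _)))
      simpa using this
    exact tendsto_of_tendsto_of_tendsto_of_le_of_le tendsto_const_nhds hup (fun _ => zero_le)
      fun n => eLpNorm_le_eLpNorm_mul_rpow_measure_univ one_le_two
        ((hφ n).memLp.sub w.memLp_toFun).1
  have hcn : Tendsto (fun n => eLpNorm (fun _ : Space d => c n - c') 2 μ) atTop (𝓝 0) := by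
    have h3 : Tendsto (fun n => ‖c n - c'‖ₑ) atTop (𝓝 0) := by
      have := (hcc.sub_const c').enorm
      simpa using this
    have h4 := ENNReal.Tendsto.mul_const (b := μ Set.univ ^ (1 / (2 : ℝ≥0∞).toReal)) h3
      (Or.inr (ENNReal.rpow_ne_top_of_nonneg (by norm_num) (measure_ne_top _ _)))
    rw [zero_mul] at h4
    refine h4.congr fun n => ?_
    rw [eLpNorm_const' _ two_ne_zero ENNReal.ofNat_ne_top]
  obtain ⟨C, hC, hpoin⟩ := exists_poincare d N
  have hg : Tendsto (fun n => C * eLpNorm (gradient (φ n)) 2 μ) atTop (𝓝 0) := by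
    have := ENNReal.Tendsto.const_mul (a := C) h2 (Or.inr hC)
    rw [mul_zero] at this
    refine this.congr fun n => ?_
    congr 1
    refine eLpNorm_congr_ae ?_
    filter_upwards [h] with x hx
    simp [hx]
  have hφc : Tendsto (fun n => eLpNorm (fun x => φ n x - c n) 2 μ) atTop (𝓝 0) := by
    refine tendsto_of_tendsto_of_tendsto_of_le_of_le tendsto_const_nhds hg (fun _ => zero_le)
      fun n => ?_
    refine (hpoin _ ((hφ n).sub (smoothPeriodic_const (c n)))
      (integral_sub_average (hφi n))).trans (le_of_eq ?_)
    congr 2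
    exact funext fun x => gradient_sub_const' _ x
  -- Since `φ n → w` and `φ n - c n → 0`, the constants `c n` converge to `w` in `L²`; they also
  -- converge to `c'`, so `w = c'`.
  have hlim := tendsto_eLpNorm_sub (μ := μ) (f := φ) (g := fun n x => φ n x - c n)
    (F := w.toFun) (G := fun _ => 0) (fun n => (hφ n).memLp)
    (fun n => (hφ n).memLp.sub (memLp_const _)) w.memLp_toFun (memLp_const 0) h1
    (by simpa using hφc)
  have hlim2 := tendsto_eLpNorm_sub (μ := μ) (f := fun n (_ : Space d) => c n)
    (g := fun n (_ : Space d) => c n) (F := w.toFun) (G := fun _ => c')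
    (fun n => memLp_const _) (fun n => memLp_const _) w.memLp_toFun (memLp_const _)
    (by simpa using hlim) hcn
  have hz : eLpNorm (fun x => w.toFun x - c') 2 μ = 0 := by
    refine tendsto_nhds_unique (tendsto_const_nhds (x := _) (f := (atTop : Filter ℕ))) ?_
    refine hlim2.congr fun n => ?_
    rw [← eLpNorm_neg]
    congr 1
    ext x
    simp
  have hz := (eLpNorm_eq_zero_iff (w.memLp_toFun.sub (memLp_const c')).1 two_ne_zero).1 hz
  refine ⟨c', w.periodic_toFun.ae_of_ae_cube (p := fun y => y = c') ?_⟩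
  filter_upwards [hz] with x hx
  exact sub_eq_zero.1 hx

end H1Per

/-! ### Elliptic problems in `H¹_per(Q_N)` -/

section Elliptic

variable {d N : ℕ}

/-- The vector `A w`. -/
def mulE (A : Matrix (Fin d) (Fin d) ℝ) (w : Space d) : Space d := WithLp.toLp 2 (A *ᵥ w.ofLp)

theorem mulE_apply (A : Matrix (Fin d) (Fin d) ℝ) (w : Space d) (i : Fin d) :
    mulE A w i = ∑ j, A i j * w j := rfl

theorem form_eq_inner (A : Matrix (Fin d) (Fin d) ℝ) (v w : Space d) :
    form A v w = inner ℝ v (mulE A w) := by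
  simp [form, mulE, PiLp.inner_apply, dotProduct, mul_comm]

theorem mulE_add (A : Matrix (Fin d) (Fin d) ℝ) (v w : Space d) :
    mulE A (v + w) = mulE A v + mulE A w := by
  simp [mulE, mulVec_add]

theorem mulE_smul (A : Matrix (Fin d) (Fin d) ℝ) (c : ℝ) (w : Space d) :
    mulE A (c • w) = c • mulE A w := by
  simp [mulE, mulVec_smul]

theorem form_add_left (A : Matrix (Fin d) (Fin d) ℝ) (v v' w : Space d) :
    form A (v + v') w = form A v w + form A v' w := by simp [form, add_dotProduct]

theorem form_add_right (A : Matrix (Fin d) (Fin d) ℝ) (v w w' : Space d) :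
    form A v (w + w') = form A v w + form A v w' := by simp [form, mulVec_add, dotProduct_add]

theorem form_sub_right (A : Matrix (Fin d) (Fin d) ℝ) (v w w' : Space d) :
    form A v (w - w') = form A v w - form A v w' := by simp [form, mulVec_sub, dotProduct_sub]

theorem form_comm {A : Matrix (Fin d) (Fin d) ℝ} (hA : A.IsSymm) (v w : Space d) :
    form A v w = form A w v := by
  rw [form, form, dotProduct_mulVec, dotProduct_comm, ← mulVec_transpose, hA.eq]

/-- A crude constant, from comparing the Euclidean norm with the sum of the coordinates; only its
dependence on `d` and `K` alone matters. -/
theorem norm_mulE_le {A : Matrix (Fin d) (Fin d) ℝ} {K : ℝ} (hK : ∀ i j, |A i j| ≤ K)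
    (w : Space d) : ‖mulE A w‖ ≤ d * (d * K) * ‖w‖ := by
  have h1 : ‖mulE A w‖ ≤ ∑ i, ‖mulE A w i‖ := by
    have h := EuclideanSpace.norm_eq (mulE A w)
    rw [h]
    refine Real.sqrt_le_iff.2 ⟨Finset.sum_nonneg fun _ _ => norm_nonneg _, ?_⟩
    exact Finset.sum_sq_le_sq_sum_of_nonneg fun _ _ => norm_nonneg _
  have h2 : ∀ i, ‖mulE A w i‖ ≤ d * K * ‖w‖ := by
    intro i
    rw [mulE_apply]
    refine (norm_sum_le _ _).trans ((Finset.sum_le_sum (g := fun _ => K * ‖w‖) fun j _ => ?_).trans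
      (le_of_eq ?_))
    · rw [norm_mul]
      have := (abs_nonneg _).trans (hK i j)
      gcongr
      · exact hK i j
      · exact PiLp.norm_apply_le w j
    · simp [mul_assoc]
  refine h1.trans ((Finset.sum_le_sum fun i _ => h2 i).trans (le_of_eq ?_))
  simp [mul_assoc]

/-- A matrix field with bounded measurable entries. -/
def BoundedField {X : Type*} [MeasurableSpace X] (μ : Measure X)
    (a : X → Matrix (Fin d) (Fin d) ℝ) : Prop :=
  AEMeasurableField μ a ∧ ∃ K : ℝ, ∀ᵐ x ∂μ, ∀ i j, |a x i j| ≤ K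

section

variable {X : Type*} [MeasurableSpace X] {μ : Measure X} {a : X → Matrix (Fin d) (Fin d) ℝ}

theorem BoundedField.memLp_mulE (ha : BoundedField μ a) {w : X → Space d} (hw : MemLp w 2 μ) :
    MemLp (fun x => mulE (a x) (w x)) 2 μ := by
  obtain ⟨hm, K, hK⟩ := ha
  refine MemLp.of_le_mul hw ?_ (hK.mono fun x hx => norm_mulE_le hx (w x))
  have hc : ∀ i, AEStronglyMeasurable (fun x => ∑ j, a x i j * w x j) μ := by
    intro i
    refine Finset.aestronglyMeasurable_fun_sum _ fun j _ => (hm i j).mul ?_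
    exact (EuclideanSpace.proj (𝕜 := ℝ) j).continuous.comp_aestronglyMeasurable hw.1
  have h : AEMeasurable (fun x i => ∑ j, a x i j * w x j) μ :=
    aemeasurable_pi_lambda _ fun i => (hc i).aemeasurable
  exact (PiLp.continuous_toLp 2 _).comp_aestronglyMeasurable h.aestronglyMeasurable

theorem integrable_inner_of_memLp {v w : X → Space d} (hv : MemLp v 2 μ) (hw : MemLp w 2 μ) :
    Integrable (fun x => inner ℝ (v x) (w x)) μ := by
  refine (L2.integrable_inner (𝕜 := ℝ) hv.toLp hw.toLp).congr ?_
  filter_upwards [hv.coeFn_toLp, hw.coeFn_toLp] with x h1 h2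
  rw [h1, h2]

theorem inner_toLp_eq {v w : X → Space d} (hv : MemLp v 2 μ) (hw : MemLp w 2 μ) :
    inner ℝ hv.toLp hw.toLp = ∫ x, inner ℝ (v x) (w x) ∂μ := by
  rw [L2.inner_def]
  refine integral_congr_ae ?_
  filter_upwards [hv.coeFn_toLp, hw.coeFn_toLp] with x h1 h2
  rw [h1, h2]

theorem BoundedField.integrable_form (ha : BoundedField μ a) {v w : X → Space d}
    (hv : MemLp v 2 μ) (hw : MemLp w 2 μ) : Integrable (fun x => form (a x) (v x) (w x)) μ := by
  simp only [form_eq_inner]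
  exact integrable_inner_of_memLp hv (ha.memLp_mulE hw)

/-- Multiplication by the field as a bounded operator, so that the bilinear form of the problem is
`⟨T u, v⟩` and its continuity is automatic. -/
theorem BoundedField.exists_mulL (ha : BoundedField μ a) :
    ∃ T : Lp (Space d) 2 μ →L[ℝ] Lp (Space d) 2 μ, ∀ u,
      T u = (ha.memLp_mulE (Lp.memLp u)).toLp := by
  obtain ⟨K, hK⟩ := ha.2
  refine ⟨LinearMap.mkContinuous
    { toFun := fun u => (ha.memLp_mulE (Lp.memLp u)).toLp
      map_add' := fun u v => ?_
      map_smul' := fun c u => ?_ } (d * (d * K)) fun u => ?_, fun u => rfl⟩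
  · rw [← MemLp.toLp_add, MemLp.toLp_eq_toLp_iff]
    filter_upwards [Lp.coeFn_add u v] with x hx
    simp only [hx, Pi.add_apply, mulE_add]
  · rw [RingHom.id_apply, ← MemLp.toLp_const_smul, MemLp.toLp_eq_toLp_iff]
    filter_upwards [Lp.coeFn_smul c u] with x hx
    simp only [hx, Pi.smul_apply, mulE_smul]
  · refine Lp.norm_le_mul_norm_of_ae_le_mul ?_
    filter_upwards [hK, (ha.memLp_mulE (Lp.memLp u)).coeFn_toLp] with x hx h1
    simp only [LinearMap.coe_mk, AddHom.coe_mk, h1]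
    exact norm_mulE_le hx _

/-- Almost everywhere coercivity. -/
def CoerciveField (μ : Measure X) (a : X → Matrix (Fin d) (Fin d) ℝ) : Prop :=
  ∃ γ : ℝ, 0 < γ ∧ ∀ᵐ x ∂μ, ∀ ξ : Space d, γ * ‖ξ‖ ^ 2 ≤ form (a x) ξ ξ

/-- Lax-Milgram for a coercive matrix field in a closed subspace of `L²`. -/
theorem exists_mem_forall_integral_form (ha : BoundedField μ a) (hc : CoerciveField μ a)
    (V : Submodule ℝ (Lp (Space d) 2 μ)) (hV : IsClosed (V : Set (Lp (Space d) 2 μ)))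
    {b : X → Space d} (hb : MemLp b 2 μ) :
    ∃ u ∈ V, ∀ v ∈ V,
      (∫ x, form (a x) (v x) (u x) ∂μ) + ∫ x, inner ℝ (v x) (b x) ∂μ = 0 := by
  have : CompleteSpace V := hV.completeSpace_coe
  obtain ⟨T, hT⟩ := ha.exists_mulL
  have hTi : ∀ u v, inner ℝ (T u) v = ∫ x, form (a x) (v x) (u x) ∂μ := by
    intro u v
    rw [real_inner_comm, hT, L2.inner_def]
    refine integral_congr_ae ?_
    filter_upwards [(ha.memLp_mulE (Lp.memLp u)).coeFn_toLp] with x h1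
    rw [h1, form_eq_inner]
  let B : V →L[ℝ] V →L[ℝ] ℝ :=
    (LinearMap.mk₂ ℝ (fun u v : V => inner ℝ (T u) (v : Lp (Space d) 2 μ))
      (fun u u' v => by simp [inner_add_left]) (fun c u v => by simp [real_inner_smul_left])
      (fun u v v' => by simp [inner_add_right])
      (fun c u v => by simp [real_inner_smul_right])).mkContinuous₂ ‖T‖ fun u v =>
        (norm_inner_le_norm _ _).trans
          (mul_le_mul_of_nonneg_right (T.le_opNorm _) (norm_nonneg _))
  have hB : ∀ u v : V, B u v = inner ℝ (T u) (v : Lp (Space d) 2 μ) := fun u v => rfl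
  have hcoer : IsCoercive B := by
    obtain ⟨γ, hγ, hcx⟩ := hc
    refine ⟨γ, hγ, fun u => ?_⟩
    rw [hB, hTi]
    have h1 : ‖u‖ * ‖u‖ = ∫ x, ‖(u : Lp (Space d) 2 μ) x‖ ^ 2 ∂μ := by
      rw [← real_inner_self_eq_norm_mul_norm, Submodule.coe_inner, L2.inner_def]
      simp only [real_inner_self_eq_norm_sq]
    rw [mul_assoc, h1, ← integral_const_mul]
    refine integral_mono_ae ((Lp.memLp _).integrable_norm_pow two_ne_zero |>.const_mul γ)
      (ha.integrable_form (Lp.memLp _) (Lp.memLp _)) ?_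
    filter_upwards [hcx] with x hx
    exact hx _
  -- The datum `b` stands on the left-hand side of the equation, hence the sign of the functional.
  let ℓ : V →L[ℝ] ℝ := (innerSL ℝ (-hb.toLp)).comp V.subtypeL
  set f : V := (InnerProductSpace.toDual ℝ V).symm ℓ with hf
  set u : V := hcoer.continuousLinearEquivOfBilin.symm f with hu
  refine ⟨u, u.2, fun v hv => ?_⟩
  have h1 := hcoer.continuousLinearEquivOfBilin_apply u ⟨v, hv⟩
  rw [hu, ContinuousLinearEquiv.apply_symm_apply, ← hu, hf,
    InnerProductSpace.toDual_symm_apply, hB, hTi] at h1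
  rw [← h1]
  have h2 : ℓ ⟨v, hv⟩ = inner ℝ (-hb.toLp) v := rfl
  rw [h2, inner_neg_left, real_inner_comm, L2.inner_def, neg_add_eq_zero]
  refine integral_congr_ae ?_
  filter_upwards [hb.coeFn_toLp] with x hx
  rw [hx]

end

/-- The unknown is the gradient, for which the form is coercive without any quotient by constants;
the function is recovered afterwards. -/
theorem exists_h1Per_solution {a : Space d → Matrix (Fin d) (Fin d) ℝ}
    (ha : BoundedField (volume.restrict (cube d N)) a)
    (hc : CoerciveField (volume.restrict (cube d N)) a) {b : Space d → Space d}
    (hb : MemLp b 2 (volume.restrict (cube d N))) :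
    ∃ w : H1Per d N, ∀ φ : H1Per d N,
      (∫ x in cube d N, form (a x) (φ.grad x) (w.grad x)) +
        ∫ x in cube d N, inner ℝ (φ.grad x) (b x) = 0 := by
  obtain ⟨u, hu, huv⟩ := exists_mem_forall_integral_form ha hc (potentialFields d N)
    (Submodule.isClosed_topologicalClosure _) hb
  obtain ⟨w, hw⟩ := exists_h1Per_of_mem hu
  refine ⟨w, fun φ => ?_⟩
  rw [← huv _ φ.toLp_grad_mem]
  congr 1
  · refine integral_congr_ae ?_
    filter_upwards [hw, φ.memLp_grad.coeFn_toLp] with x h1 h2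
    rw [h1, h2]
  · refine integral_congr_ae ?_
    filter_upwards [φ.memLp_grad.coeFn_toLp] with x h2
    rw [h2]

/-- Testing with the difference of the two functions, coercivity forces its gradient to vanish on
the cell, hence everywhere by periodicity. -/
theorem H1Per.eqUpToConst_of_forall {a : Space d → Matrix (Fin d) (Fin d) ℝ}
    (ha : BoundedField (volume.restrict (cube d N)) a)
    (hc : CoerciveField (volume.restrict (cube d N)) a) {w w' : H1Per d N}
    (h : ∀ φ : H1Per d N, ∫ x in cube d N, form (a x) (φ.grad x) (w.grad x) =
      ∫ x in cube d N, form (a x) (φ.grad x) (w'.grad x)) : w.EqUpToConst w' := by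
  set δ := w.sub w' with hδ
  have h0 : ∫ x in cube d N, form (a x) (δ.grad x) (δ.grad x) = 0 := by
    have h1 : ∀ x, form (a x) (δ.grad x) (δ.grad x) =
        form (a x) (δ.grad x) (w.grad x) - form (a x) (δ.grad x) (w'.grad x) := fun x =>
      form_sub_right _ _ _ _
    simp only [h1]
    rw [integral_sub (ha.integrable_form δ.memLp_grad w.memLp_grad)
      (ha.integrable_form δ.memLp_grad w'.memLp_grad), h δ, sub_self]
  obtain ⟨γ, hγ, hcx⟩ := hc
  have hz : δ.grad =ᵐ[volume.restrict (cube d N)] 0 := by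
    have hnn : 0 ≤ᵐ[volume.restrict (cube d N)]
        fun x => form (a x) (δ.grad x) (δ.grad x) := by
      filter_upwards [hcx] with x hx
      exact le_trans (by positivity) (hx (δ.grad x))
    have := (integral_eq_zero_iff_of_nonneg_ae hnn
      (ha.integrable_form δ.memLp_grad δ.memLp_grad)).1 h0
    filter_upwards [this, hcx] with x h1 h2
    have h3 := h2 (δ.grad x)
    rw [h1] at h3
    have h4 : ‖δ.grad x‖ ^ 2 ≤ 0 := by
      simp only [Pi.zero_apply] at h3
      nlinarith
    have h5 : ‖δ.grad x‖ = 0 := pow_eq_zero_iff two_ne_zero |>.1 (le_antisymm h4 (by positivity))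
    simpa using h5
  obtain ⟨c, hcst⟩ := δ.exists_const_of_grad_eq_zero hz
  refine ⟨⟨c, ?_⟩, ?_⟩
  · filter_upwards [hcst] with x hx
    have : w.toFun x - w'.toFun x = c := hx
    linarith
  · filter_upwards [δ.periodic_grad.ae_of_ae_cube (p := fun y => y = 0) hz] with x hx
    exact sub_eq_zero.1 hx

end Elliptic

/-! ### Consequences of the expansion and of stationarity -/

section Coefficients

variable {d : ℕ}

theorem ae_abs_le_of_linftyNorm_le {X : Type*} [MeasurableSpace X] {μ : Measure X}
    {A : X → Matrix (Fin d) (Fin d) ℝ} {K : ℝ} (hK : 0 ≤ K)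
    (h : linftyNorm μ A ≤ ENNReal.ofReal K) : ∀ᵐ x ∂μ, ∀ i j, |A x i j| ≤ K := by
  refine ae_all_iff.2 fun i => ae_all_iff.2 fun j => ?_
  have h1 : eLpNorm (fun x => A x i j) ∞ μ ≤ ENNReal.ofReal K :=
    (le_iSup₂ (f := fun i j => eLpNorm (fun x => A x i j) ∞ μ) i j).trans h
  rw [eLpNorm_exponent_top] at h1
  filter_upwards [ae_le_eLpNormEssSup (f := fun x => A x i j) (μ := μ)] with x hx
  have h2 := hx.trans h1
  rw [← ofReal_norm, ENNReal.ofReal_le_ofReal_iff hK] at h2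
  exact h2

theorem exists_ae_abs_le_of_linftyNorm_lt_top {X : Type*} [MeasurableSpace X] {μ : Measure X}
    {A : X → Matrix (Fin d) (Fin d) ℝ} (h : linftyNorm μ A < ∞) :
    ∃ K : ℝ, ∀ᵐ x ∂μ, ∀ i j, |A x i j| ≤ K :=
  ⟨(linftyNorm μ A).toReal, ae_abs_le_of_linftyNorm_le ENNReal.toReal_nonneg
    (ENNReal.ofReal_toReal h.ne).ge⟩

theorem continuous_form_left (v w : Space d) :
    Continuous fun A : Matrix (Fin d) (Fin d) ℝ => form A v w := by
  unfold form dotProduct mulVec dotProduct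
  fun_prop

theorem continuous_form_right (A : Matrix (Fin d) (Fin d) ℝ) :
    Continuous fun ξ : Space d => form A ξ ξ := by
  unfold form dotProduct mulVec dotProduct
  fun_prop

theorem ae_of_forall_ae_cube_add {p : Space d → Prop}
    (h : ∀ k : Fin d → ℤ, ∀ᵐ x ∂volume.restrict (cube d 0), p (x + latticeVec k)) :
    ∀ᵐ x, p x := by
  have h1 : ∀ᵐ x, ∀ k : Fin d → ℤ, x + latticeVec (-k) ∈ cube d 0 → p x := by
    refine ae_all_iff.2 fun k => ?_
    have h2 := h k
    rw [ae_restrict_iff' (measurableSet_cube d 0)] at h2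
    filter_upwards [(quasiMeasurePreserving_add_right (latticeVec (-k))).ae h2] with x hx hm
    have := hx hm
    rwa [latticeVec_neg, neg_add_cancel_right] at this
  filter_upwards [h1] with x hx
  refine hx (fun i => round (x i)) ?_
  have := fold_mem_cube 0 x
  rw [latticeVec_neg, ← sub_eq_add_neg]
  simpa [fold] using this

theorem BoundedField.restrict {X : Type*} [MeasurableSpace X] {μ : Measure X}
    {a : X → Matrix (Fin d) (Fin d) ℝ} (ha : BoundedField μ a) (s : Set X) :
    BoundedField (μ.restrict s) a :=
  ⟨fun i j => (ha.1 i j).restrict, ha.2.imp fun _ hK => ae_restrict_of_ae hK⟩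

theorem CoerciveField.restrict {X : Type*} [MeasurableSpace X] {μ : Measure X}
    {a : X → Matrix (Fin d) (Fin d) ℝ} (ha : CoerciveField μ a) (s : Set X) :
    CoerciveField (μ.restrict s) a :=
  ha.imp fun _ h => ⟨h.1, ae_restrict_of_ae h.2⟩

variable {Ω : Type*} [MeasurableSpace Ω] {P : Measure Ω} [IsProbabilityMeasure P]
  [AddAction (Fin d → ℤ) Ω]
  {A : ℝ → Space d → Ω → Matrix (Fin d) (Fin d) ℝ}
  {Aper : Space d → Matrix (Fin d) (Fin d) ℝ} {A₁ : Space d → Ω → Matrix (Fin d) (Fin d) ℝ}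

omit [IsProbabilityMeasure P] in
theorem WeaklyStochastic.boundedField_Aper (hA : WeaklyStochastic P A Aper A₁) :
    BoundedField volume Aper := by
  obtain ⟨K, hK⟩ := exists_ae_abs_le_of_linftyNorm_lt_top hA.bounded_Aper
  exact ⟨hA.measurable_Aper, K,
    hA.periodic_Aper.ae_of_ae_cube (p := fun M => ∀ i j, |M i j| ≤ K) hK⟩

omit [AddAction (Fin d → ℤ) Ω] in
theorem ae_prod_restrict {p : Space d × Ω → Prop} {s : Set (Space d)}
    (h : ∀ᵐ z ∂((volume : Measure (Space d)).prod P), p z) :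
    ∀ᵐ z ∂((volume.restrict s).prod P), p z :=
  (Measure.AbsolutelyContinuous.prod Measure.absolutelyContinuous_restrict
    Measure.AbsolutelyContinuous.rfl).ae_le h

/-- Coercivity is a closed condition with a constant independent of `η`, and the expansion makes
`A_η` converge to `A_per` on `Q × Ω` along `η = 1 / (n + 1)`. -/
theorem WeaklyStochastic.coerciveField_Aper (hA : WeaklyStochastic P A Aper A₁) :
    CoerciveField volume Aper := by
  obtain ⟨γ, hγ, hcoer⟩ := hA.coercive_A
  obtain ⟨K, hK⟩ := exists_ae_abs_le_of_linftyNorm_lt_top hA.bounded_A₁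
  obtain ⟨C, hC⟩ := hA.expansion
  refine ⟨γ, hγ, ?_⟩
  refine hA.periodic_Aper.ae_of_ae_cube
    (p := fun M => ∀ ξ : Space d, γ * ‖ξ‖ ^ 2 ≤ form M ξ ξ) ?_
  set η : ℕ → ℝ := fun n => 1 / ((n : ℝ) + 1) with hη
  have hη0 : ∀ n, 0 < η n := fun n => by positivity
  have hη1 : ∀ n, |η n| ≤ 1 := by
    intro n
    rw [abs_of_pos (hη0 n)]
    exact (div_le_one (by positivity)).2 (by linarith [n.cast_nonneg (α := ℝ)])
  have hηlim : Tendsto η atTop (𝓝 0) := tendsto_one_div_add_atTop_nhds_zero_nat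
  -- In the hypothesis the exceptional null set depends on `ξ`; a countable dense set of vectors
  -- makes it uniform, and continuity in `ξ` recovers all vectors.
  have h1 : ∀ᵐ z ∂((volume.restrict (cube d 0)).prod P), ∀ n m : ℕ,
      γ * ‖TopologicalSpace.denseSeq (Space d) m‖ ^ 2 ≤
        form (A (η n) z.1 z.2) (TopologicalSpace.denseSeq (Space d) m)
          (TopologicalSpace.denseSeq (Space d) m) :=
    ae_all_iff.2 fun n => ae_all_iff.2 fun m => ae_prod_restrict (hcoer _ (hη1 n) _)
  have h2 : ∀ᵐ z ∂((volume.restrict (cube d 0)).prod P), ∀ n : ℕ, ∀ i j,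
      |(A (η n) z.1 z.2 - Aper z.1 - η n • A₁ z.1 z.2) i j| ≤ |C| * η n ^ 2 :=
    ae_all_iff.2 fun n => ae_abs_le_of_linftyNorm_le (by positivity)
      ((hC _ (hη0 n).ne' (hη1 n)).trans
        (ENNReal.ofReal_le_ofReal (by gcongr; exact le_abs_self C)))
  have h3 : ∀ᵐ z ∂((volume.restrict (cube d 0)).prod P),
      ∀ ξ : Space d, γ * ‖ξ‖ ^ 2 ≤ form (Aper z.1) ξ ξ := by
    filter_upwards [h1, h2, hK] with z hz1 hz2 hz3
    have hlim : Tendsto (fun n => A (η n) z.1 z.2) atTop (𝓝 (Aper z.1)) := by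
      refine tendsto_pi_nhds.2 fun i => tendsto_pi_nhds.2 fun j => ?_
      rw [tendsto_iff_dist_tendsto_zero]
      have hb : Tendsto (fun n => |C| * η n ^ 2 + η n * K) atTop (𝓝 0) := by
        have := ((hηlim.pow 2).const_mul |C|).add (hηlim.mul_const K)
        simpa using this
      refine squeeze_zero (fun _ => dist_nonneg) (fun n => ?_) hb
      have h4 := hz2 n i j
      have h5 := hz3 i j
      simp only [Matrix.sub_apply, Matrix.smul_apply, smul_eq_mul] at h4
      rw [Real.dist_eq]
      have h6 := abs_add_le (A (η n) z.1 z.2 i j - Aper z.1 i j - η n * A₁ z.1 z.2 i j)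
        (η n * A₁ z.1 z.2 i j)
      rw [sub_add_cancel, abs_mul, abs_of_pos (hη0 n)] at h6
      have h7 := mul_le_mul_of_nonneg_left h5 (hη0 n).le
      linarith
    have hdense : ∀ m : ℕ, γ * ‖TopologicalSpace.denseSeq (Space d) m‖ ^ 2 ≤
        form (Aper z.1) (TopologicalSpace.denseSeq (Space d) m)
          (TopologicalSpace.denseSeq (Space d) m) := fun m =>
      ge_of_tendsto' (((continuous_form_left _ _).tendsto _).comp hlim) fun n => hz1 n m
    intro ξ
    have hcl : IsClosed {ξ : Space d | γ * ‖ξ‖ ^ 2 ≤ form (Aper z.1) ξ ξ} :=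
      isClosed_le (by fun_prop) (continuous_form_right _)
    have hsub : Set.range (TopologicalSpace.denseSeq (Space d)) ⊆
        {ξ : Space d | γ * ‖ξ‖ ^ 2 ≤ form (Aper z.1) ξ ξ} := by
      rintro _ ⟨m, rfl⟩
      exact hdense m
    exact hcl.closure_subset_iff.2 hsub (TopologicalSpace.denseRange_denseSeq (Space d) ξ)
  filter_upwards [Measure.ae_ae_of_ae_prod h3] with x hx
  -- The property does not involve `ω`, and an almost sure event of a probability space is nonempty.
  exact hx.exists.choose_spec

omit [AddAction (Fin d → ℤ) Ω] in
theorem ae_ae_swap {X : Type*} [MeasurableSpace X] {μ : Measure X} [SFinite μ] {p : X × Ω → Prop}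
    (h : ∀ᵐ z ∂(μ.prod P), p z) : ∀ᵐ ω ∂P, ∀ᵐ x ∂μ, p (x, ω) :=
  Measure.ae_ae_of_ae_prod
    ((Measure.measurePreserving_swap (μ := P) (ν := μ)).quasiMeasurePreserving.ae h)

theorem WeaklyStochastic.ae_stationary (hA : WeaklyStochastic P A Aper A₁) :
    ∀ᵐ ω ∂P, ∀ k : Fin d → ℤ, ∀ᵐ x, A₁ (x + latticeVec k) ω = A₁ x (k +ᵥ ω) :=
  ae_all_iff.2 fun k => ae_ae_swap (hA.stationary_A₁ k)

theorem WeaklyStochastic.boundedField_prod (hA : WeaklyStochastic P A Aper A₁) :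
    BoundedField ((volume.restrict (cube d 0)).prod P) fun z => A₁ z.1 z.2 :=
  ⟨fun i j => (hA.measurable_A₁ i j).mono_ac (Measure.AbsolutelyContinuous.prod
    Measure.absolutelyContinuous_restrict Measure.AbsolutelyContinuous.rfl),
    exists_ae_abs_le_of_linftyNorm_lt_top hA.bounded_A₁⟩

/-- The bound is assumed on `Q × Ω` only. Stationarity carries it to each translated cell, at the
cost of countably many null sets, which the measure-preserving maps `τ_k` pull back to null sets. -/
theorem WeaklyStochastic.ae_boundedField_A₁ [MeasurableConstVAdd (Fin d → ℤ) Ω]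
    [VAddInvariantMeasure (Fin d → ℤ) Ω P] (hA : WeaklyStochastic P A Aper A₁) :
    ∀ᵐ ω ∂P, BoundedField volume fun x => A₁ x ω := by
  obtain ⟨K, hK⟩ := hA.boundedField_prod.2
  have h1 : ∀ᵐ ω ∂P, ∀ k : Fin d → ℤ, ∀ᵐ x ∂volume.restrict (cube d 0),
      ∀ i j, |A₁ x (k +ᵥ ω) i j| ≤ K :=
    ae_all_iff.2 fun k => (measurePreserving_vadd k P).quasiMeasurePreserving.ae (ae_ae_swap hK)
  have h2 : ∀ᵐ ω ∂P, ∀ i j, AEStronglyMeasurable (fun x => A₁ x ω i j) volume :=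
    ae_all_iff.2 fun i => ae_all_iff.2 fun j => (hA.measurable_A₁ i j).prod_swap.prodMk_left
  filter_upwards [h1, h2, hA.ae_stationary] with ω hω1 hω2 hω3
  refine ⟨hω2, K, ae_of_forall_ae_cube_add fun k => ?_⟩
  filter_upwards [hω1 k, ae_restrict_of_ae (hω3 k)] with x hx1 hx2
  rw [hx2]
  exact hx1

end Coefficients

/-! ### The periodic corrector on large cubes -/

section LargeCubes

variable {d N : ℕ}

/-- The box is a complete system of residues modulo `2N+1` in each coordinate, so a translation
followed by reduction permutes it. -/
theorem sum_box_add_of_periodic {F : (Fin d → ℤ) → ℝ}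
    (hF : ∀ k m : Fin d → ℤ, F (k + fun i => (2 * (N : ℤ) + 1) * m i) = F k) (m : Fin d → ℤ) :
    ∑ k ∈ box d N, F (k + m) = ∑ k ∈ box d N, F k := by
  have hL : 0 < 2 * (N : ℤ) + 1 := by positivity
  have hmem : ∀ k : Fin d → ℤ, (fun i => (k i + N) % (2 * (N : ℤ) + 1) - N) ∈ box d N := by
    intro k
    refine mem_box.2 fun i => abs_le.2 ?_
    have h1 := Int.emod_nonneg (k i + N) hL.ne'
    have h2 := Int.emod_lt_of_pos (k i + N) hL
    constructor <;> linarith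
  have hred : ∀ k ∈ box d N, ∀ i, (k i + N) % (2 * (N : ℤ) + 1) = k i + N := by
    intro k hk i
    have := abs_le.1 (mem_box.1 hk i)
    exact Int.emod_eq_of_lt (by linarith) (by linarith)
  refine Finset.sum_nbij' (fun k i => ((k + m) i + N) % (2 * (N : ℤ) + 1) - N)
    (fun k i => ((k - m) i + N) % (2 * (N : ℤ) + 1) - N)
    (fun k _ => hmem _) (fun k _ => hmem _) ?_ ?_ ?_
  · intro k hk
    ext i
    simp only [Pi.sub_apply, Pi.add_apply]
    rw [sub_right_comm, sub_add_cancel, Int.emod_sub_emod, show k i + m i + N - m i = k i + N by ring,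
      hred k hk, add_sub_cancel_right]
  · intro k hk
    ext i
    simp only [Pi.sub_apply, Pi.add_apply]
    rw [show ∀ a : ℤ, a - N + m i + N = a + m i by intro a; ring, Int.emod_add_emod,
      show k i - m i + N + m i = k i + N by ring, hred k hk, add_sub_cancel_right]
  · intro k _
    rw [← hF (fun i => ((k + m) i + N) % (2 * (N : ℤ) + 1) - N)
      fun i => ((k + m) i + N) / (2 * (N : ℤ) + 1)]
    congr 1
    ext i
    have := Int.emod_add_mul_ediv ((k + m) i + N) (2 * (N : ℤ) + 1)
    simp only [Pi.add_apply] at *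
    linarith

/-- The sum of the translates of a smooth `Q_N`-periodic function by the integer vectors of `Q_N`
is `Q`-periodic. -/
theorem SmoothPeriodic.sum_translates {φ : Space d → ℝ} (hφ : SmoothPeriodic N φ) :
    SmoothPeriodic 0 fun x => ∑ k ∈ box d N, φ (x + latticeVec k) := by
  refine ⟨ContDiff.sum fun k _ => hφ.1.comp (contDiff_id.add contDiff_const), fun m x => ?_⟩
  have := sum_box_add_of_periodic (N := N) (F := fun k => φ (x + latticeVec k)) (fun k l => ?_) m
  · simp only
    rw [← this]
    refine Finset.sum_congr rfl fun k _ => ?_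
    congr 1
    rw [latticeVec_add, CharP.cast_eq_zero, mul_zero, zero_add, one_smul]
    abel
  · rw [latticeVec_add, ← smul_latticeVec, ← add_assoc, hφ.2]

/-- Cutting `Q_N` into unit cells, on each of which `q` is the same, leaves the integral over `Q` of
`q` against the gradient of the sum of translates of `φ`, an admissible test function. -/
theorem integral_inner_gradient_eq_zero {q : Space d → Space d} (hq : PeriodicAE 0 q)
    (hq2 : MemLp q 2 (volume.restrict (cube d 0)))
    (h : ∀ φ : H1Per d 0, ∫ x in cube d 0, inner ℝ (φ.grad x) (q x) = 0) {φ : Space d → ℝ}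
    (hφ : SmoothPeriodic N φ) : ∫ x in cube d N, inner ℝ (gradient φ x) (q x) = 0 := by
  have hint : IntegrableOn (fun x => inner ℝ (gradient φ x) (q x)) (cube d N) :=
    integrable_inner_of_memLp hφ.memLp_gradient (memLp_cube_of_periodic hq hq2)
  have hk : ∀ k : Fin d → ℤ, ∀ᵐ x ∂volume.restrict (cube d 0),
      inner ℝ (gradient φ (x + latticeVec k)) (q (x + latticeVec k)) =
        inner ℝ (gradient φ (x + latticeVec k)) (q x) := fun k =>
    ae_restrict_of_ae ((hq.add_latticeVec k).mono fun x hx => by rw [hx])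
  have hint0 : ∀ k : Fin d → ℤ,
      IntegrableOn (fun x => inner ℝ (gradient φ (x + latticeVec k)) (q x)) (cube d 0) := fun k =>
    integrable_inner_of_memLp
      (memLp_cube_of_continuous (hφ.continuous_gradient.comp (by fun_prop)) 2) hq2
  rw [integral_cube_eq_sum hint, Finset.sum_congr rfl fun k _ => integral_congr_ae (hk k),
    ← integral_finsetSum _ fun k _ => hint0 k, ← h (H1Per.ofSmooth hφ.sum_translates)]
  congr 1
  ext x
  rw [← sum_inner]
  congr 1
  change _ = gradient (fun x => ∑ k ∈ box d N, φ (x + latticeVec k)) x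
  rw [gradient_sum' (f := fun k x => φ (x + latticeVec k)) _ fun k =>
    hφ.differentiable.comp (by fun_prop)]
  exact Finset.sum_congr rfl fun k _ => (gradient_comp_add _ _).symm

/-- A `Q`-periodic field that is orthogonal to the gradients of `Q`-periodic functions is orthogonal
to the gradients of `Q_N`-periodic functions. -/
theorem integral_inner_grad_eq_zero {q : Space d → Space d} (hq : PeriodicAE 0 q)
    (hq2 : MemLp q 2 (volume.restrict (cube d 0)))
    (h : ∀ φ : H1Per d 0, ∫ x in cube d 0, inner ℝ (φ.grad x) (q x) = 0) (φ : H1Per d N) :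
    ∫ x in cube d N, inner ℝ (φ.grad x) (q x) = 0 := by
  have hqN : MemLp q 2 (volume.restrict (cube d N)) := memLp_cube_of_periodic hq hq2
  have hle : potentialFields d N ≤ (ℝ ∙ hqN.toLp)ᗮ := by
    refine Submodule.topologicalClosure_minimal _ ?_ (Submodule.isClosed_orthogonal _)
    rintro _ ⟨ψ, hψ, rfl⟩
    rw [Submodule.mem_orthogonal_singleton_iff_inner_left, inner_toLp_eq]
    exact integral_inner_gradient_eq_zero hq hq2 h hψ
  have := hle φ.toLp_grad_mem
  rwa [Submodule.mem_orthogonal_singleton_iff_inner_left, inner_toLp_eq] at this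

/-- This makes `w^{1,N}`, which is only `Q_N`-periodic, admissible in the equation of `w⁰`. -/
theorem IsCorrectorZero.integral_form_eq_zero {Aper : Space d → Matrix (Fin d) (Fin d) ℝ}
    (hper : PeriodicAE 0 Aper) (hb : BoundedField volume Aper) {p : Space d} {w : H1Per d 0}
    (hw : IsCorrectorZero Aper p w) (φ : H1Per d N) :
    ∫ x in cube d N, form (Aper x) (φ.grad x) (p + w.grad x) = 0 := by
  simp only [IsCorrectorZero, form_eq_inner] at hw ⊢
  refine integral_inner_grad_eq_zero (q := fun x => mulE (Aper x) (p + w.grad x)) ?_ ?_ hw φ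
  · exact (hper.prodMk w.periodic_grad).comp fun z => mulE z.1 (p + z.2)
  · exact (hb.restrict _).memLp_mulE ((memLp_const p).add w.memLp_grad)

end LargeCubes

/-! ### The first order correction -/

section FirstOrder

variable {d : ℕ} {Aper : Space d → Matrix (Fin d) (Fin d) ℝ}

theorem exists_isCorrectorZero (hb : BoundedField volume Aper) (hc : CoerciveField volume Aper)
    (p : Space d) : ∃ w : H1Per d 0, IsCorrectorZero Aper p w := by
  have hp : MemLp (fun _ : Space d => p) 2 (volume.restrict (cube d 0)) := memLp_const p
  obtain ⟨w, hw⟩ := exists_h1Per_solution (hb.restrict _) (hc.restrict _)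
    ((hb.restrict (cube d 0)).memLp_mulE hp)
  refine ⟨w, fun φ => ?_⟩
  simp only [← form_eq_inner] at hw
  simp only [form_add_right]
  rw [integral_add ((hb.restrict _).integrable_form φ.memLp_grad hp)
    ((hb.restrict _).integrable_form φ.memLp_grad w.memLp_grad), add_comm]
  exact hw φ

theorem IsCorrectorZero.eqUpToConst (hb : BoundedField volume Aper)
    (hc : CoerciveField volume Aper) {p : Space d} {w w' : H1Per d 0}
    (hw : IsCorrectorZero Aper p w) (hw' : IsCorrectorZero Aper p w') : w.EqUpToConst w' := by
  refine H1Per.eqUpToConst_of_forall (hb.restrict _) (hc.restrict _) fun φ => ?_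
  have hp : MemLp (fun _ : Space d => p) 2 (volume.restrict (cube d 0)) := memLp_const p
  have h1 := hw φ
  have h2 := hw' φ
  simp only [form_add_right] at h1 h2
  rw [integral_add ((hb.restrict _).integrable_form φ.memLp_grad hp)
    ((hb.restrict _).integrable_form φ.memLp_grad (H1Per.memLp_grad _))] at h1 h2
  linarith

variable {N : ℕ} {a₁ : Space d → Matrix (Fin d) (Fin d) ℝ}

theorem memLp_const_add_grad (p : Space d) (w : H1Per d 0) :
    MemLp (fun x => p + w.grad x) 2 (volume.restrict (cube d N)) :=
  (memLp_const p).add (w.ofZero N).memLp_grad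

theorem exists_isCorrectorOne (hb : BoundedField volume Aper) (hc : CoerciveField volume Aper)
    (hb₁ : BoundedField volume a₁) (p : Space d) (w₀ : H1Per d 0) :
    ∃ w : H1Per d N, IsCorrectorOne N Aper a₁ p w₀ w := by
  obtain ⟨w, hw⟩ := exists_h1Per_solution (hb.restrict _) (hc.restrict _)
    ((hb₁.restrict (cube d N)).memLp_mulE (memLp_const_add_grad p w₀))
  simp only [← form_eq_inner] at hw
  exact ⟨w, hw⟩

theorem IsCorrectorOne.eqUpToConst (hb : BoundedField volume Aper)
    (hc : CoerciveField volume Aper) {p : Space d} {w₀ : H1Per d 0} {w w' : H1Per d N}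
    (hw : IsCorrectorOne N Aper a₁ p w₀ w) (hw' : IsCorrectorOne N Aper a₁ p w₀ w') :
    w.EqUpToConst w' := by
  refine H1Per.eqUpToConst_of_forall (hb.restrict _) (hc.restrict _) fun φ => ?_
  have h1 := hw φ
  have h2 := hw' φ
  linarith

/-- The matrix `A^{⋆,N}_1` depends on the periodic correctors only. -/
theorem firstOrderMatrix_apply (hper : PeriodicAE 0 Aper) (hb : BoundedField volume Aper)
    (hsymm : ∀ᵐ x, (Aper x).IsSymm) (hb₁ : BoundedField volume a₁) {w₀ : Fin d → H1Per d 0}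
    {w₁ : Fin d → H1Per d N} (h₀ : ∀ j, IsCorrectorZero Aper (basisVec j) (w₀ j))
    (h₁ : ∀ j, IsCorrectorOne N Aper a₁ (basisVec j) (w₀ j) (w₁ j)) (i j : Fin d) :
    firstOrderMatrix N Aper a₁ w₀ w₁ i j = ((2 * (N : ℝ) + 1) ^ d)⁻¹ *
      ∫ x in cube d N,
        form (a₁ x) (basisVec i + (w₀ i).grad x) (basisVec j + (w₀ j).grad x) := by
  have hbN := hb.restrict (cube d N)
  have hb₁N := hb₁.restrict (cube d N)
  have he : ∀ i : Fin d, MemLp (fun _ : Space d => basisVec i) 2 (volume.restrict (cube d N)) :=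
    fun i => memLp_const _
  have hg : ∀ i, MemLp (w₀ i).grad 2 (volume.restrict (cube d N)) := fun i =>
    ((w₀ i).ofZero N).memLp_grad
  have hu : MemLp (fun x => basisVec j + (w₀ j).grad x) 2 (volume.restrict (cube d N)) :=
    memLp_const_add_grad _ _
  -- The equation of `w₀ i` tested with `w₁ j`; symmetry of `Aper` exchanges the two arguments.
  have h1 : (∫ x in cube d N, form (Aper x) (basisVec i) ((w₁ j).grad x)) +
      ∫ x in cube d N, form (Aper x) ((w₀ i).grad x) ((w₁ j).grad x) = 0 := by
    rw [← integral_add (hbN.integrable_form (he i) (w₁ j).memLp_grad)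
      (hbN.integrable_form (hg i) (w₁ j).memLp_grad),
      ← (h₀ i).integral_form_eq_zero hper hb (w₁ j)]
    refine integral_congr_ae ?_
    filter_upwards [ae_restrict_of_ae hsymm] with x hx
    rw [← form_add_left, form_comm hx]
  -- The equation of `w₁ j` tested with `w₀ i`. Together with `h1` it replaces the term in `w₁ j` by
  -- an integral of `a₁`.
  have h2 : (∫ x in cube d N, form (Aper x) ((w₀ i).grad x) ((w₁ j).grad x)) +
      ∫ x in cube d N, form (a₁ x) ((w₀ i).grad x) (basisVec j + (w₀ j).grad x) = 0 :=
    h₁ j ((w₀ i).ofZero N)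
  have h3 : ∫ x in cube d N,
        form (a₁ x) (basisVec i + (w₀ i).grad x) (basisVec j + (w₀ j).grad x) =
      (∫ x in cube d N, form (a₁ x) (basisVec i) (basisVec j + (w₀ j).grad x)) +
        ∫ x in cube d N, form (a₁ x) ((w₀ i).grad x) (basisVec j + (w₀ j).grad x) := by
    rw [← integral_add (hb₁N.integrable_form (he i) hu) (hb₁N.integrable_form (hg i) hu)]
    simp only [form_add_left]
  simp only [firstOrderMatrix, of_apply, volume_real_cube, h3]
  simp only [add_comm ((w₀ j).grad _)]
  rw [← mul_add]
  congr 1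
  linarith

variable {Ω : Type*} [MeasurableSpace Ω] {P : Measure Ω} [IsProbabilityMeasure P]
  [AddAction (Fin d → ℤ) Ω]
  {A : ℝ → Space d → Ω → Matrix (Fin d) (Fin d) ℝ} {A₁ : Space d → Ω → Matrix (Fin d) (Fin d) ℝ}

-- Stationarity moves each translation in space to the action on `Ω`, so the integral becomes an
-- orbit sum of a single random variable, the form integrated over the unit cell.
omit [MeasurableSpace Ω] in
theorem integral_cube_form_eq_sum {ω : Ω} (hb : BoundedField volume fun x => A₁ x ω)
    (hst : ∀ k : Fin d → ℤ, ∀ᵐ x, A₁ (x + latticeVec k) ω = A₁ x (k +ᵥ ω)) {v u : Space d → Space d}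
    (hv : PeriodicAE 0 v) (hu : PeriodicAE 0 u) (hv2 : MemLp v 2 (volume.restrict (cube d 0)))
    (hu2 : MemLp u 2 (volume.restrict (cube d 0))) (N : ℕ) :
    ∫ x in cube d N, form (A₁ x ω) (v x) (u x) =
      ∑ k ∈ box d N, ∫ x in cube d 0, form (A₁ x (k +ᵥ ω)) (v x) (u x) := by
  rw [integral_cube_eq_sum ((hb.restrict _).integrable_form (memLp_cube_of_periodic hv hv2)
    (memLp_cube_of_periodic hu hu2))]
  refine Finset.sum_congr rfl fun k _ => integral_congr_ae (ae_restrict_of_ae ?_)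
  filter_upwards [hst k, hv.add_latticeVec k, hu.add_latticeVec k] with x h1 h2 h3
  rw [h1, h2, h3]

theorem form_eq_sum (M : Matrix (Fin d) (Fin d) ℝ) (v u : Space d) :
    form M v u = ∑ i, ∑ j, v i * u j * M i j := by
  simp only [form, dotProduct, mulVec, Finset.mul_sum]
  exact Finset.sum_congr rfl fun i _ => Finset.sum_congr rfl fun j _ => by ring

section

variable (hA : WeaklyStochastic P A Aper A₁) {v u : Space d → Space d}
  (hv : MemLp v 2 (volume.restrict (cube d 0))) (hu : MemLp u 2 (volume.restrict (cube d 0)))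

include hA hv hu

theorem WeaklyStochastic.integrable_form_prod :
    Integrable (fun z : Space d × Ω => form (A₁ z.1 z.2) (v z.1) (u z.1))
      ((volume.restrict (cube d 0)).prod P) :=
  hA.boundedField_prod.integrable_form (hv.comp_fst P) (hu.comp_fst P)

/-- The fields `v` and `u` are deterministic and `A₁` is bounded, so the cell integral is
essentially bounded in `ω`, although `v` and `u` are merely in `L²`. -/
theorem WeaklyStochastic.memLp_integral_form :
    MemLp (fun ω => ∫ x in cube d 0, form (A₁ x ω) (v x) (u x)) 2 P := by
  obtain ⟨K, hK⟩ := hA.boundedField_prod.2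
  refine MemLp.of_bound (hA.integrable_form_prod hv hu).integral_prod_right.1
    (∫ x in cube d 0, ‖v x‖ * (d * (d * K) * ‖u x‖)) ?_
  filter_upwards [ae_ae_swap hK] with ω hω
  refine norm_integral_le_of_norm_le (hv.norm.integrable_mul (hu.norm.const_mul _)) ?_
  filter_upwards [hω] with x hx
  rw [form_eq_inner]
  refine (norm_inner_le_norm _ _).trans ?_
  gcongr
  exact norm_mulE_le hx _

/-- Fubini, then linearity of the form in the matrix: the deterministic factors `v` and `u` come out
of the expectation. -/
theorem WeaklyStochastic.integral_integral_form :
    ∫ ω, (∫ x in cube d 0, form (A₁ x ω) (v x) (u x)) ∂P =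
      ∫ x in cube d 0, form (expectation P A₁ x) (v x) (u x) := by
  rw [← integral_integral_swap (hA.integrable_form_prod hv hu)]
  obtain ⟨hm, K, hK⟩ := hA.boundedField_prod
  have hint : ∀ᵐ x ∂volume.restrict (cube d 0), ∀ i j, Integrable (fun ω => A₁ x ω i j) P := by
    refine ae_all_iff.2 fun i => ae_all_iff.2 fun j => ?_
    have h : Integrable (fun z : Space d × Ω => A₁ z.1 z.2 i j)
        ((volume.restrict (cube d 0)).prod P) :=
      Integrable.of_bound (hm i j) K (hK.mono fun z hz => hz i j)
    exact h.prod_right_ae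
  refine integral_congr_ae ?_
  filter_upwards [hint] with x hx
  simp only [form_eq_sum, expectation, of_apply]
  rw [integral_finsetSum _ fun i _ => integrable_finsetSum _ fun j _ => (hx i j).const_mul _]
  refine Finset.sum_congr rfl fun i _ => ?_
  rw [integral_finsetSum _ fun j _ => (hx i j).const_mul _]
  exact Finset.sum_congr rfl fun j _ => integral_const_mul _ _

end

/-- Almost sure convergence of the first order correction on large cubes. -/
theorem WeaklyStochastic.tendsto_firstOrderMatrix [MeasurableConstVAdd (Fin d → ℤ) Ω]
    [ErgodicVAdd (Fin d → ℤ) Ω P] (hA : WeaklyStochastic P A Aper A₁)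
    (hsymm : ∀ᵐ x, (Aper x).IsSymm) {w₀ : Fin d → H1Per d 0}
    (h₀ : ∀ j, IsCorrectorZero Aper (basisVec j) (w₀ j)) {w₁ : (N : ℕ) → Fin d → Ω → H1Per d N}
    (h₁ : ∀ N j, ∀ᵐ ω ∂P,
      IsCorrectorOne N Aper (fun x => A₁ x ω) (basisVec j) (w₀ j) (w₁ N j ω)) :
    ∀ᵐ ω ∂P, Tendsto
      (fun N : ℕ => firstOrderMatrix N Aper (fun x => A₁ x ω) w₀ fun j => w₁ N j ω)
      atTop (𝓝 (limitMatrix P A₁ w₀)) := by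
  have hv : ∀ i, MemLp (fun x => basisVec i + (w₀ i).grad x) 2 (volume.restrict (cube d 0)) :=
    fun i => memLp_const_add_grad _ _
  have hvp : ∀ i, PeriodicAE 0 fun x => basisVec i + (w₀ i).grad x := fun i =>
    (w₀ i).periodic_grad.comp fun y => basisVec i + y
  have herg : ∀ᵐ ω ∂P, ∀ i j, Tendsto (fun N => boxAverage (d := d) (fun ω => ∫ x in cube d 0,
      form (A₁ x ω) (basisVec i + (w₀ i).grad x) (basisVec j + (w₀ j).grad x)) N ω) atTop
      (𝓝 (∫ ω, (∫ x in cube d 0,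
        form (A₁ x ω) (basisVec i + (w₀ i).grad x) (basisVec j + (w₀ j).grad x)) ∂P)) :=
    ae_all_iff.2 fun i => ae_all_iff.2 fun j =>
      averageConverges_of_memLp_two (hA.memLp_integral_form (hv i) (hv j))
  filter_upwards [herg, hA.ae_stationary, hA.ae_boundedField_A₁,
    ae_all_iff.2 fun N => ae_all_iff.2 fun j => h₁ N j] with ω hω hst hb h1
  refine tendsto_pi_nhds.2 fun i => tendsto_pi_nhds.2 fun j => ?_
  have := hω i j
  rw [hA.integral_integral_form (hv i) (hv j)] at this
  -- Nothing is left to estimate: for each `N` the matrix entry equals the box average.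
  refine this.congr fun N => ?_
  rw [firstOrderMatrix_apply hA.periodic_Aper hA.boundedField_Aper hsymm hb h₀ (h1 N) i j,
    integral_cube_form_eq_sum hb hst (hvp i) (hvp j) (hv i) (hv j) N, boxAverage]

end FirstOrder

end PerturbedHomogenization

end

theorem mainTheorem4 {d : ℕ} (hd : 1 ≤ d) {Ω : Type*} [MeasurableSpace Ω]
    (P : Measure Ω) [IsProbabilityMeasure P]
    [AddAction (Fin d → ℤ) Ω] [MeasurableConstVAdd (Fin d → ℤ) Ω]
    [ErgodicVAdd (Fin d → ℤ) Ω P]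
    (A : ℝ → Space d → Ω → Matrix (Fin d) (Fin d) ℝ)
    (Aper : Space d → Matrix (Fin d) (Fin d) ℝ)
    (A₁ : Space d → Ω → Matrix (Fin d) (Fin d) ℝ)
    (hA : WeaklyStochastic P A Aper A₁)
    (hA_symm : ∀ η : ℝ, |η| ≤ 1 → SymmetricAE P (A η))
    (hA₁_symm : SymmetricAE P A₁)
    (hAper_symm : ∀ᵐ x, (Aper x).IsSymm) :
    -- `w⁰_p` exists and is unique up to an additive constant
    (∀ p : Space d, (∃ w : H1Per d 0, IsCorrectorZero Aper p w) ∧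
      ∀ w w' : H1Per d 0, IsCorrectorZero Aper p w → IsCorrectorZero Aper p w' →
        w.EqUpToConst w') ∧
    -- almost surely, `w^{1,N}_p(·, ω)` exists and is unique up to an additive constant, for all `N`
    (∀ (p : Space d) (w₀ : H1Per d 0), IsCorrectorZero Aper p w₀ →
      ∀ᵐ ω ∂P, ∀ N : ℕ,
        (∃ w : H1Per d N, IsCorrectorOne N Aper (fun x => A₁ x ω) p w₀ w) ∧
        ∀ w w' : H1Per d N, IsCorrectorOne N Aper (fun x => A₁ x ω) p w₀ w →
          IsCorrectorOne N Aper (fun x => A₁ x ω) p w₀ w' → w.EqUpToConst w') ∧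
    -- almost surely, `A^{⋆,N}_1(ω)` tends to `A^⋆_1`
    (∀ w₀ : Fin d → H1Per d 0, (∀ j, IsCorrectorZero Aper (basisVec j) (w₀ j)) →
      ∀ w₁ : (N : ℕ) → Fin d → Ω → H1Per d N,
        (∀ N j, ∀ᵐ ω ∂P,
          IsCorrectorOne N Aper (fun x => A₁ x ω) (basisVec j) (w₀ j) (w₁ N j ω)) →
        ∀ᵐ ω ∂P, Tendsto
          (fun N : ℕ => firstOrderMatrix N Aper (fun x => A₁ x ω) w₀ fun j => w₁ N j ω)
          atTop (𝓝 (limitMatrix P A₁ w₀))) := by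
  have hb := hA.boundedField_Aper
  have hc := hA.coerciveField_Aper
  refine ⟨fun p => ⟨exists_isCorrectorZero hb hc p, fun w w' hw hw' => hw.eqUpToConst hb hc hw'⟩,
    fun p w₀ _ => ?_, fun w₀ h₀ w₁ h₁ => hA.tendsto_firstOrderMatrix hAper_symm h₀ h₁⟩
  filter_upwards [hA.ae_boundedField_A₁] with ω hω N
  exact ⟨exists_isCorrectorOne hb hc hω p w₀, fun w w' hw hw' => hw.eqUpToConst hb hc hw'⟩
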